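/- **Conventions.** Link diagrams are drawn on the sphere. At a crossing $c$ we fix compass directions: the four ends of its strands are NE, NW, SW, SE. Put $\operatorname{sign}(c)=1$ if the overstrand runs from SW to NE and $\operatorname{sign}(c)=-1$ if it runs from NW to SE. The $A$-smoothing at a crossing joins the two regions that are swept out when the overstrand is rotated counterclockwise until it meets the understrand; the $B$-smoothing joins the other two. Given a checkerboard colouring of the regions of a diagram, the Tait graph $G$ has the shaded regions as vertices and one edge for each crossing, joining the two shaded regions that meet there. An edge is positive if the $A$-smoothing at its crossing joins the two unshaded regions (so that this smoothing deletes the edge), and negative otherwise. Let $s_v$ be the number of spanning trees of $G$ with exactly $v$ positive edges. The determinant of a connected diagram is $\left|\sum_v(-1)^v s_v\right|$, which does not depend on the colouring; the determinant of a disconnected diagram (a split link) is $0$. For nonzero integers $a_1,\dots,a_n$ $(n\ge 1)$ of the same sign, the rational tangle with denominators $[a_1,\dots,a_n]$ is Conway's tangle $a_1a_2\cdots a_n$: begin with $|a_1|$ horizontal crossings, each of the sign of $a_1$; then, for $i=2,\dots,n$ in turn, reflect in the vertical plane through the line NW–SE and add $|a_i|$ horizontal crossings, each of the sign of $a_i$,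 on the east side. Its slope is $$\frac{\beta}{\alpha}=\cfrac{1}{a_n+\cfrac{1}{a_{n-1}+\cfrac{1}{\ddots+\cfrac{1}{a_1}}}},\qquad \alpha>0,\quad \gcd(\alpha,\beta)=1 .$$ **Lemma 2.2.** Let $c$ be a crossing of a diagram of a link $L$, and let $L_0$ and $L_1$ be the links obtained by the $A$- and the $B$-smoothing at $c$. Choose a checkerboard colouring of the diagram of $L$ for which the edge of $c$ is positive, give the diagrams of $L_0$ and $L_1$ the induced colourings, and put $$x=\sum_v(-1)^v s_{v-1}(L_0),\qquad y=\sum_v(-1)^v s_v(L_1).$$ Let $L^*$ be the link obtained from $L$ by replacing $c$ by a rational tangle of slope $\beta/\alpha$ with denominators $a_1,\dots,a_n$ that all have the same sign as $c$. Then $$\det(L^*)=\begin{cases}\bigl|\,\alpha\det(L_0)+\operatorname{sign}(xy)\,\beta\,\det(L_1)\,\bigr| & \text{if }\operatorname{sign}(c)=1,\\[2pt] \bigl|\,\alpha\det(L_1)+\operatorname{sign}(xy)\,|\beta|\,\det(L_0)\,\bigr| & \text{if }\operatorname{sign}(c)=-1,\end{cases}$$ where $\operatorname{sign}(0)$ is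 read as $1$. -/

import Mathlib

/-! Link diagrams on the sphere, their Tait graphs and determinants, rational tangles.

Every node of a diagram sits in a small disc with four ports in counterclockwise order,
`0 = NE`, `1 = NW`, `2 = SW`, `3 = SE`.  The corner `i` of a node is the sector between the
ports `i` and `i + 1`, so `0 = N`, `1 = W`, `2 = S`, `3 = E`.  (Arithmetic in `Fin 4` is mod 4.) -/

/-- What is drawn inside the disc of a node: a crossing, or the result of smoothing one. -/
inductive Elem where
  /-- the crossing of sign `1`: the overstrand runs from SW to NE (positive slope) -/
  | pos
  /-- the crossing of sign `-1`: the overstrand runs from NW to SE (negative slope) -/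
  | neg
  /-- the two arcs `)(`, that is NW to SW and NE to SE -/
  | vert
  /-- two horizontal arcs, NW to NE and SW to SE -/
  | horiz

namespace Elem

/-- The element is a crossing. -/
def IsCrossing (e : Elem) : Prop := e = pos ∨ e = neg

/-- The `A`-smoothing: it opens a channel between the two regions swept out when the overstrand
is rotated counterclockwise (N and S for `pos`, W and E for `neg`). -/
def smoothA : Elem → Elem
  | pos => vert
  | neg => horiz
  | e => e

/-- The `B`-smoothing, the other one. -/
def smoothB : Elem → Elem
  | pos => horiz
  | neg => vert
  | e => e

/-- Ports `i`, `j` of a node lie on a common piece of the projection inside the disc. -/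
def PortsJoined : Elem → Fin 4 → Fin 4 → Prop
  | pos, _, _ => True
  | neg, _, _ => True
  | vert, i, j => j = i ∨ j = 3 - i
  | horiz, i, j => j = i ∨ j = 1 - i

/-- Corners `i`, `j` of a node belong to the same region already inside the disc. -/
def CornersJoined : Elem → Fin 4 → Fin 4 → Prop
  | vert, i, j => i = 0 ∧ j = 2
  | horiz, i, j => i = 1 ∧ j = 3
  | _, _, _ => False

/-- Reflection in the vertical plane through the line NW-SE.  Overstrands stay over, and the
slopes of the strands of a crossing do not change. -/
def reflect : Elem → Elem
  | vert => horiz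
  | horiz => vert
  | e => e

end Elem

/-- A diagram: finitely many nodes, whose ports are joined in pairs by arcs without crossings.
It is drawn on the closed oriented surface obtained by gluing a disc to each boundary walk; this
surface is a union of spheres if `Diagram.IsPlanar` holds.  The nodes that are crossings are the
crossings of the diagram; the smoothed nodes are just places where arcs pass (they record
smoothings, and allow components without crossings). -/
structure Diagram where
  Node : Type
  finite : Finite Node
  elem : Node → Elem
  glue : Node × Fin 4 → Node × Fin 4
  glue_glue : ∀ p, glue (glue p) = p
  glue_ne : ∀ p, glue p ≠ p

/-- A finite set of edges is a spanning tree: it connects all vertices and it has no cycle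
(no edge of it joins two vertices that are connected by the other edges of it). -/
def Graph.IsSpanningTree {V E : Type*} (G : Graph V E) (S : Set E) : Prop :=
  S ⊆ G.edgeSet ∧
  (∀ u ∈ G.vertexSet, ∀ v ∈ G.vertexSet,
    Relation.ReflTransGen (fun a b => ∃ e ∈ S, G.IsLink e a b) u v) ∧
  (∀ e ∈ S, ∀ u v, G.IsLink e u v →
    ¬ Relation.ReflTransGen (fun a b => ∃ f ∈ S \ {e}, G.IsLink f a b) u v)

namespace Diagram

/-- Ports, and likewise corners, of the nodes. -/
abbrev Flag (D : Diagram) : Type := D.Node × Fin 4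

/-- The corner `i` lies on the counterclockwise side of the port `i`.  Following that side of the
arc which starts at port `i` of `x` and ends at port `j` of `y`, one comes to corner `j - 1`
of `y`. -/
def across (D : Diagram) (q : D.Flag) : D.Flag := ((D.glue q).1, (D.glue q).2 - 1)

/-- Euler's formula `V - E + F = 2 C` for the 4-valent graph formed by the nodes and the arcs
(with `E = 2 V`, `F` boundary walks and `C` connected components): each component of the surface
that carries the diagram is a sphere. -/
def IsPlanar (D : Diagram) : Prop :=
  Nat.card D.Node + 2 * Nat.card (Quot fun x y : D.Node => ∃ i, (D.glue (x, i)).1 = y) =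
    Nat.card (Quot fun q r : D.Flag => r = D.across q)

/-- The projection of the link is connected. -/
def IsConnected (D : Diagram) : Prop :=
  ∀ p q : D.Flag, Relation.ReflTransGen
    (fun a b => b = D.glue a ∨ a.1 = b.1 ∧ (D.elem a.1).PortsJoined a.2 b.2) p q

/-- Two corners are adjacent parts of the same region: along an arc, or through a channel that a
smoothing opens. -/
def SameRegion (D : Diagram) (q r : D.Flag) : Prop :=
  r = D.across q ∨ q.1 = r.1 ∧ (D.elem q.1).CornersJoined q.2 r.2

/-- The regions of the diagram. -/
def Region (D : Diagram) : Type := Quot D.SameRegion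

/-- The region of a corner. -/
def region (D : Diagram) (q : D.Flag) : D.Region := Quot.mk _ q

/-- A set `σ` of corners (the shaded ones) is a checkerboard colouring: it is constant on regions,
and the two sides of every arc have different colours. -/
def IsCheckerboard (D : Diagram) (σ : Set D.Flag) : Prop :=
  (∀ x i, (x, i + 1) ∈ σ ↔ (x, i) ∉ σ) ∧ ∀ q, D.across q ∈ σ ↔ q ∈ σ

/-- The Tait graph of a diagram with a checkerboard colouring.  Vertices are the shaded regions;
each crossing is an edge that joins the two shaded regions at opposite corners of it. -/
def taitGraph (D : Diagram) (σ : Set D.Flag) : Graph D.Region D.Node where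
  vertexSet := {r | ∃ q ∈ σ, D.region q = r}
  IsLink x u v := (D.elem x).IsCrossing ∧
    ∃ i, (x, i) ∈ σ ∧ (x, i + 2) ∈ σ ∧ (∀ k, (x, k) ∈ σ → k = i ∨ k = i + 2) ∧
      D.region (x, i) = u ∧ D.region (x, i + 2) = v
  isLink_symm := by
    rintro x -
    refine ⟨?_⟩
    rintro u v ⟨hx, i, h1, h2, h3, h4, h5⟩
    have e : i + 2 + 2 = i := (by decide : ∀ i : Fin 4, i + 2 + 2 = i) i
    exact ⟨hx, i + 2, h2, by rwa [e], fun k hk => by rw [e]; exact (h3 k hk).symm, h5, by rwa [e]⟩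
  eq_or_eq_of_isLink_of_isLink := by
    rintro x u v u' v' ⟨-, i, -, -, h3, rfl, rfl⟩ ⟨-, j, g1, -, -, rfl, rfl⟩
    have e : i + 2 + 2 = i := (by decide : ∀ i : Fin 4, i + 2 + 2 = i) i
    rcases h3 j g1 with rfl | rfl
    · exact Or.inl rfl
    · right; rw [e]
  left_mem_of_isLink := by
    rintro x u v ⟨-, i, h1, -, -, h4, -⟩
    exact ⟨_, h1, h4⟩

/-- The edge of the crossing `x` is positive: the `A`-smoothing at `x` opens the channel between
the two unshaded corners, so it deletes the edge (and the `B`-smoothing contracts it). -/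
def IsPositiveEdge (D : Diagram) (σ : Set D.Flag) (x : D.Node) : Prop :=
  D.elem x = Elem.pos ∧ (x, 1) ∈ σ ∨ D.elem x = Elem.neg ∧ (x, 0) ∈ σ

/-- The number `s_v` of spanning trees of the Tait graph with exactly `v` positive edges. -/
noncomputable def treeCount (D : Diagram) (σ : Set D.Flag) (v : ℕ) : ℕ :=
  Set.ncard {S : Set D.Node | (D.taitGraph σ).IsSpanningTree S ∧
    Set.ncard {x ∈ S | D.IsPositiveEdge σ x} = v}

/-- The signed count `∑ (-1)^v s_v` of spanning trees.  A tree has at most as many edges as there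
are nodes, so the sum over all `v` is finite. -/
noncomputable def treeSum (D : Diagram) (σ : Set D.Flag) : ℤ :=
  ∑ v ∈ Finset.range (Nat.card D.Node + 1), (-1) ^ v * (D.treeCount σ v : ℤ)

/-- The shifted sum `∑ (-1)^v s_(v-1)` over `v ≥ 1`, written with `v + 1` for `v`. -/
noncomputable def shiftedTreeSum (D : Diagram) (σ : Set D.Flag) : ℤ :=
  ∑ v ∈ Finset.range (Nat.card D.Node + 1), (-1) ^ (v + 1) * (D.treeCount σ v : ℤ)

open Classical in
/-- The determinant of a link diagram: `|∑ (-1)^v s_v|` for the Tait graph of a checkerboard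
colouring.  For connected planar diagrams a colouring exists and the value does not depend on it.
A planar diagram that is not connected shows a split link, whose determinant is `0`. -/
noncomputable def det (D : Diagram) : ℕ :=
  if h : D.IsConnected ∧ ∃ σ, D.IsCheckerboard σ then (D.treeSum h.2.choose).natAbs else 0

open Classical in
/-- Redraw the node `c`. -/
noncomputable def setElem (D : Diagram) (c : D.Node) (e : Elem) : Diagram where
  Node := D.Node
  finite := D.finite
  elem := Function.update D.elem c e
  glue := D.glue
  glue_glue := D.glue_glue
  glue_ne := D.glue_ne

/-- `L₀`: the `A`-smoothing at `c`. -/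
noncomputable def smoothA (D : Diagram) (c : D.Node) : Diagram := D.setElem c (D.elem c).smoothA

/-- `L₁`: the `B`-smoothing at `c`. -/
noncomputable def smoothB (D : Diagram) (c : D.Node) : Diagram := D.setElem c (D.elem c).smoothB

open Classical in
/-- Where the ports of `D` are found after a new node `none` has been put on side `k` of `c`: it
takes over the arcs at the ports `k` and `k + 1` of `c`. -/
noncomputable def attachPort (D : Diagram) (c : D.Node) (k : Fin 4) (p : D.Flag) :
    Option D.Node × Fin 4 :=
  if p.1 = c ∧ (p.2 = k ∨ p.2 = k + 1) then (none, p.2) else (some p.1, p.2)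

open Classical in
/-- The arcs after a new node has been put on side `k` of `c`. The ports `k`, `k + 1` of `c` are
joined to the ports `k - 1`, `k + 2` of the new node, which face them; the ports `k`, `k + 1` of
the new node continue along the arcs that used to start at these ports of `c`. -/
noncomputable def attachGlue (D : Diagram) (c : D.Node) (k : Fin 4) :
    Option D.Node × Fin 4 → Option D.Node × Fin 4
  | (none, j) =>
      if j = k ∨ j = k + 1 then D.attachPort c k (D.glue (c, j))
      else if j = k + 2 then (some c, k + 1) else (some c, k)
  | (some x, j) =>
      if x = c ∧ j = k then (none, k - 1)
      else if x = c ∧ j = k + 1 then (none, k + 2)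
      else D.attachPort c k (D.glue (x, j))

theorem attachGlue_attachPort (D : Diagram) (c : D.Node) (k : Fin 4) (p : D.Flag) :
    D.attachGlue c k (D.attachPort c k p) = D.attachPort c k (D.glue p) := by
  obtain ⟨x, j⟩ := p
  by_cases h : x = c ∧ (j = k ∨ j = k + 1)
  · obtain ⟨rfl, h⟩ := h
    simp [attachPort, attachGlue, h]
  · have h1 : ¬ (x = c ∧ j = k) := fun h' => h ⟨h'.1, Or.inl h'.2⟩
    have h2 : ¬ (x = c ∧ j = k + 1) := fun h' => h ⟨h'.1, Or.inr h'.2⟩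
    have e : D.attachPort c k (x, j) = (some x, j) := if_neg h
    rw [e]
    simp only [attachGlue, if_neg h1, if_neg h2]

theorem attachPort_injective (D : Diagram) (c : D.Node) (k : Fin 4) :
    Function.Injective (D.attachPort c k) := by
  rintro ⟨x, i⟩ ⟨y, j⟩ h
  unfold attachPort at h
  split_ifs at h with h1 h2 h2 <;> simp_all

/-- Every port of the enlarged diagram is a port of `D` or faces a port of the other node. -/
theorem attach_cases (D : Diagram) (c : D.Node) (k : Fin 4) (q : Option D.Node × Fin 4) :
    (∃ p, q = D.attachPort c k p) ∨ q = (none, k - 1) ∨ q = (none, k + 2) ∨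
      q = (some c, k) ∨ q = (some c, k + 1) := by
  obtain ⟨_ | x, j⟩ := q
  · by_cases h : j = k ∨ j = k + 1
    · exact Or.inl ⟨(c, j), by simp [attachPort, h]⟩
    · have : j = k - 1 ∨ j = k + 2 := by revert j k; decide
      rcases this with rfl | rfl <;> simp
  · by_cases h : x = c ∧ (j = k ∨ j = k + 1)
    · obtain ⟨rfl, rfl | rfl⟩ := h <;> simp
    · exact Or.inl ⟨(x, j), (if_neg h).symm⟩

theorem attachGlue_inner (D : Diagram) (c : D.Node) (k : Fin 4) :
    D.attachGlue c k (none, k - 1) = (some c, k) ∧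
    D.attachGlue c k (none, k + 2) = (some c, k + 1) ∧
    D.attachGlue c k (some c, k) = (none, k - 1) ∧
    D.attachGlue c k (some c, k + 1) = (none, k + 2) := by
  have h1 : ¬ (k - 1 = k ∨ k - 1 = k + 1) ∧ k - 1 ≠ k + 2 := by revert k; decide
  have h2 : ¬ (k + 2 = k ∨ k + 2 = k + 1) := by revert k; decide
  have h3 : k + 1 ≠ k := by revert k; decide
  refine ⟨?_, ?_, ?_, ?_⟩
  · simp only [attachGlue, if_neg h1.1, if_neg h1.2]
  · simp only [attachGlue, if_neg h2, if_true]
  · simp only [attachGlue, and_self, if_true]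
  · simp only [attachGlue, h3, and_false, if_false, and_self, if_true]

/-- Put a new node, drawn as `e`, on side `k` of the node `c` (`k = 3` is the east side, `k = 2`
the south side), inside the disc that `c` used to fill. -/
noncomputable def attach (D : Diagram) (c : D.Node) (k : Fin 4) (e : Elem) : Diagram where
  Node := Option D.Node
  finite := by have := D.finite; infer_instance
  elem := fun x => x.elim e D.elem
  glue := D.attachGlue c k
  glue_glue := by
    obtain ⟨e1, e2, e3, e4⟩ := D.attachGlue_inner c k
    intro q
    rcases D.attach_cases c k q with ⟨p, rfl⟩ | rfl | rfl | rfl | rfl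
    · rw [attachGlue_attachPort, attachGlue_attachPort, D.glue_glue]
    · rw [e1, e3]
    · rw [e2, e4]
    · rw [e3, e1]
    · rw [e4, e2]
  glue_ne := by
    obtain ⟨e1, e2, e3, e4⟩ := D.attachGlue_inner c k
    intro q
    rcases D.attach_cases c k q with ⟨p, rfl⟩ | rfl | rfl | rfl | rfl
    · rw [attachGlue_attachPort]
      exact fun h => D.glue_ne p (D.attachPort_injective c k h)
    · rw [e1]; simp
    · rw [e2]; simp
    · rw [e3]; simp
    · rw [e4]; simp

end Diagram

/-- Tangle diagrams built from one elementary tangle by adding crossings, one at a time. -/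
inductive TwistTangle where
  | elem (e : Elem)
  /-- the sum `T + e`: the crossing `e` is put to the east of `T`, its NW and SW ports being
  joined to the NE and SE ends of `T` -/
  | addEast (T : TwistTangle) (e : Elem)
  /-- the crossing `e` is put to the south of `T`, its NW and NE ports being joined to the SW and
  SE ends of `T` -/
  | addSouth (T : TwistTangle) (e : Elem)

namespace TwistTangle

/-- Reflection in the vertical plane through the line NW-SE. -/
def reflect : TwistTangle → TwistTangle
  | elem e => elem e.reflect
  | addEast T e => addSouth T.reflect e.reflect
  | addSouth T e => addEast T.reflect e.reflect

/-- Add `|a|` horizontal crossings of the sign of `a` to the east of `T`. -/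
def twist (T : TwistTangle) (a : ℤ) : TwistTangle :=
  (fun T => addEast T (if 0 < a then Elem.pos else Elem.neg))^[a.natAbs] T

/-- Conway's rational tangle `a₁ a₂ … aₙ`: begin with `a₁` horizontal crossings; then, for
`i = 2, …, n`, reflect in the line NW-SE and add `aᵢ` horizontal crossings. -/
def rational (a : List ℤ) : TwistTangle :=
  a.foldl (fun T m => T.reflect.twist m) (elem Elem.vert)

end TwistTangle

/-- The value of the continued fraction `[a₁, …, aₙ]`, that is
`1 / (aₙ + 1 / (aₙ₋₁ + ⋯ + 1 / a₁))`: the slope of the rational tangle `a₁ a₂ … aₙ`. -/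
def contFrac (a : List ℤ) : ℚ := a.foldl (fun q m => 1 / (m + q)) 0

/-- Replace the node `c` of `D` by a tangle diagram, respecting the compass directions.  To put
`T + e` in the place of `c`, put `e` on the east side of `c` and then `T` in the place
of `c`. -/
noncomputable def Diagram.replace : (D : Diagram) → (c : D.Node) → TwistTangle → Diagram
  | D, c, .elem e => D.setElem c e
  | D, c, .addEast T e => Diagram.replace (D.attach c 3 e) (some c) T
  | D, c, .addSouth T e => Diagram.replace (D.attach c 2 e) (some c) T

/-- The sign of an integer, with value `1` at `0`. -/
def sgn (t : ℤ) : ℤ := if 0 ≤ t then 1 else -1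

/-! Smooth every node of a diagram in one of the two ways.  On a sphere, the states obtained in
this way that consist of a single circle correspond to the spanning trees of the Tait graph: merging
the shaded corners at a node keeps its edge, and merging the unshaded corners deletes it.  So the
determinant is, up to sign, a sum over the one-circle states of products of one weight for each
smoothing.

In this sum two adjacent nodes can be fused into one, because contracting a node whose smoothing
lets the arcs through does not change the number of circles.  A whole tangle thus acts as a pair of
weights.  Those of a rational tangle of slope `β / α` are, up to a common sign, `α` and `-|β|`:
adding a crossing acts on the pair as `q ↦ q + 1` does on a fraction, and reflection exchanges its
members. -/

/-! ### Circles and channels -/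

section Permutations

open Equiv

variable {α : Type*} [DecidableEq α] [Finite α] {f : Perm α} {a b : α}

theorem sameCycle_swap_mul_self (hab : ¬ f.SameCycle a b) : (swap a b * f).SameCycle a b := by
  have hpow : ∀ j, (f ^ (j + 1)) a = f ((f ^ j) a) := fun j => by rw [pow_succ', Perm.mul_apply]
  obtain ⟨m, hm, hlt⟩ : ∃ m, (f ^ (m + 1)) a = a ∧ ∀ j < m, (f ^ (j + 1)) a ≠ a := by
    classical
    obtain ⟨k, hk, hka⟩ := Function.mem_periodicPts.1 (f.injective.mem_periodicPts a)
    have hex : ∃ m, (f ^ (m + 1)) a = a := ⟨k - 1, by rwa [Nat.sub_add_cancel hk, Perm.coe_pow]⟩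
    exact ⟨Nat.find hex, Nat.find_spec hex, fun j hj => Nat.find_min hex hj⟩
  have hsame : ∀ j ≤ m, (swap a b * f).SameCycle a ((f ^ j) a) := by
    intro j
    induction j with
    | zero => exact fun _ => .refl _ _
    | succ j ih =>
      intro hj
      have hne_b : (f ^ (j + 1)) a ≠ b := fun h => hab ⟨j + 1, mod_cast h⟩
      have hstep : (swap a b * f) ((f ^ j) a) = (f ^ (j + 1)) a := by
        rw [Perm.mul_apply, ← hpow, swap_apply_of_ne_of_ne (hlt j hj) hne_b]
      rw [← hstep, Perm.sameCycle_apply_right]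
      exact ih (Nat.le_of_succ_le hj)
  have hlast : (swap a b * f) ((f ^ m) a) = b := by
    rw [Perm.mul_apply, ← hpow, hm, swap_apply_left]
  have := Perm.sameCycle_apply_right.2 (hsame m le_rfl)
  rwa [hlast] at this

theorem sameCycle_swap_mul (hab : ¬ f.SameCycle a b) {u v : α} (huv : f.SameCycle u v) :
    (swap a b * f).SameCycle u v := by
  have hcycle := sameCycle_swap_mul_self hab
  have hstep : ∀ u, (swap a b * f).SameCycle u (f u) := by
    intro u
    rw [← Perm.sameCycle_apply_left, Perm.mul_apply]
    rcases eq_or_ne (f u) a with ha | ha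
    · simpa [ha] using hcycle.symm
    rcases eq_or_ne (f u) b with hb | hb
    · simpa [hb] using hcycle
    · rw [swap_apply_of_ne_of_ne ha hb]
  obtain ⟨n, rfl⟩ := huv.exists_nat_pow_eq
  induction n with
  | zero => exact .refl _ _
  | succ n ih =>
    rw [pow_succ', Perm.mul_apply]
    exact (ih ⟨n, by simp⟩).trans (hstep _)

end Permutations

theorem card_le_card_add_one_of_forall_eq_univ {V ι : Type*} [Finite ι] (f g : ι → V)
    (h : ∀ S : Set V, S.Nonempty → (∀ i, f i ∈ S ↔ g i ∈ S) → S = Set.univ) :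
    Nat.card V ≤ Nat.card ι + 1 := by
  set G := SimpleGraph.fromEdgeSet (Set.range fun i => s(f i, g i))
  cases isEmpty_or_nonempty V
  · simp
  have hadj : ∀ i (v : V), G.Reachable v (f i) ↔ G.Reachable v (g i) := by
    intro i v
    by_cases hi : f i = g i
    · rw [hi]
    · have : G.Adj (f i) (g i) := (SimpleGraph.fromEdgeSet_adj _).2 ⟨⟨i, rfl⟩, hi⟩
      exact ⟨fun hv => hv.trans this.reachable, fun hv => hv.trans this.symm.reachable⟩
  have hG : G.Connected := ⟨fun v => Set.eq_univ_iff_forall.1 <|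
    h {w | G.Reachable v w} ⟨v, .refl v⟩ fun i => hadj i v⟩
  have hfin : (Set.range fun i => s(f i, g i)).Finite := Set.finite_range _
  calc Nat.card V ≤ Nat.card G.edgeSet + 1 := hG.card_vert_le_card_edgeSet_add_one
    _ ≤ Nat.card (Set.range fun i => s(f i, g i)) + 1 := by
        gcongr
        exact Nat.card_mono hfin (by rw [SimpleGraph.edgeSet_fromEdgeSet]; exact Set.sdiff_subset)
    _ ≤ Nat.card ι + 1 := by gcongr; exact Finite.card_range_le _

/-- No proper nonempty subset is closed under both maps. -/
def JointlyTransitive {α : Type*} (i t : α → α) : Prop :=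
  ∀ A : Set α, A.Nonempty → (∀ a ∈ A, i a ∈ A) → (∀ a ∈ A, t a ∈ A) → A = Set.univ

theorem jointlyTransitive_iff_of_leftInverse {α β : Type*} {i t : α → α} {i' t' : β → β}
    (hi' : i'.Involutive) (ht' : t'.Involutive) {f : α → β} {g : β → α} (hgf : g.LeftInverse f)
    (hi : ∀ a, i' (f a) = f (i a)) (hgi : ∀ b, g (i' b) = g b ∨ g (i' b) = i (g b))
    (hgt : ∀ b, g (t' b) = g b ∨ g (t' b) = t (g b)) (hlift : ∀ a, ∃ b, g b = a ∧ g (t' b) = t a)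
    (hfg : ∀ b, f (g b) = b ∨ f (g b) = t' b ∨ f (g b) = t' (i' b)) :
    JointlyTransitive i' t' ↔ JointlyTransitive i t := by
  constructor
  · intro h A ⟨a, ha⟩ hiA htA
    have hpre : g ⁻¹' A = Set.univ := h _ ⟨f a, ?_⟩ (fun b hb => ?_) fun b hb => ?_
    · exact Set.eq_univ_of_forall fun a => hgf a ▸ Set.eq_univ_iff_forall.1 hpre (f a)
    · rwa [Set.mem_preimage, hgf]
    · rcases hgi b with e | e <;> rw [Set.mem_preimage, e]
      exacts [hb, hiA _ hb]
    · rcases hgt b with e | e <;> rw [Set.mem_preimage, e]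
      exacts [hb, htA _ hb]
  · intro h B ⟨b, hb⟩ hiB htB
    have hi_iff : ∀ b, i' b ∈ B ↔ b ∈ B := fun b => ⟨fun hb => hi' b ▸ hiB _ hb, hiB b⟩
    have ht_iff : ∀ b, t' b ∈ B ↔ b ∈ B := fun b => ⟨fun hb => ht' b ▸ htB _ hb, htB b⟩
    have hmem : ∀ b, f (g b) ∈ B ↔ b ∈ B := fun b => by
      rcases hfg b with e | e | e <;> simp only [e, hi_iff, ht_iff]
    have hpre : f ⁻¹' B = Set.univ := h _ ⟨g b, (hmem b).2 hb⟩
      (fun a ha => (hi a ▸ hiB _ ha : f (i a) ∈ B)) fun a ha => ?_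
    · exact Set.eq_univ_of_forall fun b => (hmem b).1 (Set.eq_univ_iff_forall.1 hpre (g b))
    · obtain ⟨b, rfl, hb⟩ := hlift a
      rw [Set.mem_preimage, ← hb]
      exact (hmem _).2 (htB _ ((hmem b).1 ha))

theorem fin_four_cases (k j : Fin 4) : j = k ∨ j = k - 1 ∨ j = k + 1 ∨ j = k + 2 := by
  revert j k; decide

namespace Diagram

open Relation Set

variable {D : Diagram} {σ : Set D.Flag} {U : Set D.Node}

noncomputable instance (D : Diagram) : Fintype D.Node := @Fintype.ofFinite _ D.finite

theorem IsCheckerboard.mem_succ (h : D.IsCheckerboard σ) (x : D.Node) (i : Fin 4) :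
    (x, i + 1) ∈ σ ↔ (x, i) ∉ σ := h.1 x i

theorem IsCheckerboard.mem_pred (h : D.IsCheckerboard σ) (x : D.Node) (i : Fin 4) :
    (x, i - 1) ∈ σ ↔ (x, i) ∉ σ := by
  have := h.mem_succ x (i - 1)
  rw [sub_add_cancel] at this
  tauto

theorem IsCheckerboard.mem_opp (h : D.IsCheckerboard σ) (x : D.Node) (i : Fin 4) :
    (x, i + 2) ∈ σ ↔ (x, i) ∈ σ := by
  rw [show i + 2 = i + 1 + 1 by rw [add_assoc]; rfl, h.mem_succ, h.mem_succ, not_not]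

theorem IsCheckerboard.eq_or_eq_opp (h : D.IsCheckerboard σ) {x : D.Node} {i j : Fin 4}
    (hi : (x, i) ∈ σ) (hj : (x, j) ∈ σ) : j = i ∨ j = i + 2 := by
  rcases fin_four_cases i j with rfl | rfl | rfl | rfl
  · exact .inl rfl
  · exact absurd hi ((h.mem_pred x i).1 hj)
  · exact absurd hi ((h.mem_succ x i).1 hj)
  · exact .inr rfl

theorem IsCheckerboard.rel_opp (h : D.IsCheckerboard σ) {R : D.Flag → D.Flag → Prop}
    (hR : ∀ {q r}, R q r → R r q) {x : D.Node} {i j : Fin 4} (hi : (x, i) ∈ σ) (hj : (x, j) ∈ σ)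
    (hx : R (x, i) (x, i + 2)) : R (x, j) (x, j + 2) := by
  rcases h.eq_or_eq_opp hi hj with rfl | rfl
  · exact hx
  · rw [(by decide : ∀ i : Fin 4, i + 2 + 2 = i)]
    exact hR hx

theorem IsCheckerboard.exists_mem (h : D.IsCheckerboard σ) (x : D.Node) : ∃ i, (x, i) ∈ σ := by
  by_cases h0 : (x, 0) ∈ σ
  exacts [⟨0, h0⟩, ⟨0 + 1, (h.mem_succ x 0).2 h0⟩]

theorem IsCheckerboard.compl (h : D.IsCheckerboard σ) : D.IsCheckerboard σᶜ :=
  ⟨fun x i => not_congr (h.1 x i), fun q => not_congr (h.2 q)⟩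

theorem IsCheckerboard.glue_mem (h : D.IsCheckerboard σ) (p : D.Flag) :
    D.glue p ∈ σ ↔ p ∉ σ := by
  have h1 : ((D.glue p).1, (D.glue p).2 - 1) ∈ σ ↔ p ∈ σ := h.2 p
  have h2 := h.mem_pred (D.glue p).1 (D.glue p).2
  tauto

open Classical in
/-- The other end of the arc that starts at the port `p` inside its node, when the nodes in `U`
are smoothed so that their shaded corners merge, and all other nodes so that their unshaded
corners merge.  Thus a set `U` of nodes stands for a Kauffman state of `D`. -/
noncomputable def turn (D : Diagram) (σ : Set D.Flag) (U : Set D.Node) (p : D.Flag) : D.Flag :=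
  if p ∈ σ ↔ p.1 ∉ U then (p.1, p.2 + 1) else (p.1, p.2 - 1)

theorem turn_succ {p : D.Flag} (h : p ∈ σ ↔ p.1 ∉ U) : D.turn σ U p = (p.1, p.2 + 1) := if_pos h

theorem turn_pred {p : D.Flag} (h : ¬ (p ∈ σ ↔ p.1 ∉ U)) : D.turn σ U p = (p.1, p.2 - 1) :=
  if_neg h

theorem turn_fst (p : D.Flag) : (D.turn σ U p).1 = p.1 := by
  unfold turn
  split_ifs <;> rfl

theorem turn_compl (D : Diagram) (σ : Set D.Flag) (U : Set D.Node) :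
    D.turn σᶜ Uᶜ = D.turn σ U := by
  ext1 p
  by_cases h : p ∈ σ ↔ p.1 ∉ U
  · rw [turn_succ h, turn_succ (by simp only [mem_compl_iff]; tauto)]
  · rw [turn_pred h, turn_pred (by simp only [mem_compl_iff]; tauto)]

theorem IsCheckerboard.turn_turn (h : D.IsCheckerboard σ) (U : Set D.Node) (p : D.Flag) :
    D.turn σ U (D.turn σ U p) = p := by
  obtain ⟨x, i⟩ := p
  have hsucc := h.mem_succ x i
  have hpred := h.mem_pred x i
  by_cases hp : (x, i) ∈ σ ↔ x ∉ U
  · rw [turn_succ hp, turn_pred (by dsimp only; tauto), add_sub_cancel_right]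
  · rw [turn_pred hp, turn_succ (by dsimp only; tauto), sub_add_cancel]

/-- The state `U` consists of a single circle.  This is said without naming the circles: no proper
nonempty set of ports is a union of circles. -/
def OneCircle (D : Diagram) (σ : Set D.Flag) (U : Set D.Node) : Prop :=
  JointlyTransitive D.glue (D.turn σ U)

theorem oneCircle_compl : D.OneCircle σᶜ Uᶜ ↔ D.OneCircle σ U := by
  simp only [OneCircle, turn_compl]

/-- One passes from the corner `q` to the corner `r` along arcs of the diagram and through the
channels between the shaded corners of the nodes in `U`. -/
def Linked (D : Diagram) (σ : Set D.Flag) (U : Set D.Node) : D.Flag → D.Flag → Prop :=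
  EqvGen fun q r => r = D.across q ∨ q ∈ σ ∧ q.1 ∈ U ∧ r = (q.1, q.2 + 2)

theorem linked_across (p : D.Flag) : D.Linked σ U p (D.across p) := .rel _ _ (.inl rfl)

theorem linked_opp {x : D.Node} {i : Fin 4} (hi : (x, i) ∈ σ) (hx : x ∈ U) :
    D.Linked σ U (x, i) (x, i + 2) := .rel _ _ (.inr ⟨hi, hx, rfl⟩)

theorem Linked.refl (q : D.Flag) : D.Linked σ U q q := EqvGen.refl q

theorem Linked.symm {q r : D.Flag} (h : D.Linked σ U q r) : D.Linked σ U r q := EqvGen.symm _ _ h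

theorem Linked.trans {q r s : D.Flag} (h : D.Linked σ U q r) (h' : D.Linked σ U r s) :
    D.Linked σ U q s := EqvGen.trans _ _ _ h h'

theorem Linked.induction {R : D.Flag → D.Flag → Prop} (hR : Equivalence R)
    (hacross : ∀ p, R p (D.across p))
    (hopp : ∀ x i, (x, i) ∈ σ → x ∈ U → R (x, i) (x, i + 2)) {q r : D.Flag}
    (hqr : D.Linked σ U q r) : R q r := by
  refine hR.eqvGen_iff.1 (EqvGen.mono ?_ _ _ hqr)
  rintro q _ (rfl | ⟨hq, hx, rfl⟩)
  exacts [hacross q, hopp _ _ hq hx]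

theorem Linked.mono {V : Set D.Node} (hUV : U ⊆ V) {q r : D.Flag} (hqr : D.Linked σ U q r) :
    D.Linked σ V q r :=
  hqr.induction ⟨.refl, .symm, .trans⟩ linked_across fun _ _ hi hx => linked_opp hi (hUV hx)

theorem IsCheckerboard.mem_of_linked (h : D.IsCheckerboard σ) {q r : D.Flag}
    (hqr : D.Linked σ U q r) : q ∈ σ ↔ r ∈ σ :=
  hqr.induction (R := fun q r => q ∈ σ ↔ r ∈ σ) ⟨fun _ => .rfl, .symm, .trans⟩
    (fun p => (h.2 p).symm) fun x i _ _ => (h.mem_opp x i).symm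

open Classical in
/-- The shaded one of the two corners next to the port `p`. -/
noncomputable def shadedSide (D : Diagram) (σ : Set D.Flag) (p : D.Flag) : D.Flag :=
  if p ∈ σ then p else (p.1, p.2 - 1)

theorem shadedSide_of_mem {p : D.Flag} (hp : p ∈ σ) : D.shadedSide σ p = p := if_pos hp

theorem shadedSide_of_notMem {p : D.Flag} (hp : p ∉ σ) : D.shadedSide σ p = (p.1, p.2 - 1) :=
  if_neg hp

theorem IsCheckerboard.shadedSide_mem (h : D.IsCheckerboard σ) (p : D.Flag) :
    D.shadedSide σ p ∈ σ := by
  by_cases hp : p ∈ σ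
  · rwa [shadedSide_of_mem hp]
  · rwa [shadedSide_of_notMem hp, h.mem_pred]

theorem IsCheckerboard.linked_shadedSide_glue (h : D.IsCheckerboard σ) (U : Set D.Node)
    (p : D.Flag) : D.Linked σ U (D.shadedSide σ p) (D.shadedSide σ (D.glue p)) := by
  by_cases hp : p ∈ σ
  · rw [shadedSide_of_mem hp, shadedSide_of_notMem (by rwa [h.glue_mem, not_not])]
    exact linked_across p
  · rw [shadedSide_of_notMem hp, shadedSide_of_mem ((h.glue_mem p).2 hp)]
    have := linked_across (σ := σ) (U := U) (D.glue p)
    rw [across, D.glue_glue] at this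
    exact this.symm

theorem IsCheckerboard.shadedSide_turn (h : D.IsCheckerboard σ) {p : D.Flag} (hp : p.1 ∉ U) :
    D.shadedSide σ (D.turn σ U p) = D.shadedSide σ p := by
  obtain ⟨x, i⟩ := p
  by_cases hi : (x, i) ∈ σ
  · rw [turn_succ (by simp_all), shadedSide_of_mem hi,
      shadedSide_of_notMem (by rwa [h.mem_succ, not_not]), add_sub_cancel_right]
  · rw [turn_pred (by simp_all), shadedSide_of_notMem hi, shadedSide_of_mem (by rwa [h.mem_pred])]

theorem IsCheckerboard.linked_shadedSide (h : D.IsCheckerboard σ) {x : D.Node} (hx : x ∈ U)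
    (i j : Fin 4) : D.Linked σ U (D.shadedSide σ (x, i)) (D.shadedSide σ (x, j)) := by
  have hnode : ∀ i, D.shadedSide σ (x, i) = (x, (D.shadedSide σ (x, i)).2) := fun i => by
    unfold shadedSide; split_ifs <;> rfl
  have hi := h.shadedSide_mem (x, i)
  have hj := h.shadedSide_mem (x, j)
  rw [hnode] at hi hj
  rw [hnode i, hnode j]
  rcases h.eq_or_eq_opp hi hj with e | e <;> rw [e]
  exacts [.refl _, linked_opp hi hx]

theorem IsCheckerboard.linked_shadedSide_turn (h : D.IsCheckerboard σ) (U : Set D.Node)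
    (p : D.Flag) : D.Linked σ U (D.shadedSide σ p) (D.shadedSide σ (D.turn σ U p)) := by
  by_cases hp : p.1 ∈ U
  · rw [show D.turn σ U p = (p.1, (D.turn σ U p).2) from Prod.ext (turn_fst p) rfl]
    exact h.linked_shadedSide hp _ _
  · rw [h.shadedSide_turn hp]
    exact .refl _

/-- All shaded regions are joined to each other by the channels at the nodes in `U`. -/
def ShadedConnected (D : Diagram) (σ : Set D.Flag) (U : Set D.Node) : Prop :=
  ∀ q ∈ σ, ∀ r ∈ σ, D.Linked σ U q r

theorem OneCircle.shadedConnected (h : D.IsCheckerboard σ) (hU : D.OneCircle σ U) :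
    D.ShadedConnected σ U := by
  intro q hq r hr
  have hA := hU {p | D.Linked σ U q (D.shadedSide σ p)} ⟨q, by
      rw [mem_ofPred, shadedSide_of_mem hq]; exact .refl q⟩
    (fun p hp => hp.trans (h.linked_shadedSide_glue U p))
    (fun p hp => hp.trans (h.linked_shadedSide_turn U p))
  simpa [shadedSide_of_mem hr] using eq_univ_iff_forall.1 hA r

/-- `Diagram.across` as a permutation of the corners; its orbits are the faces. -/
noncomputable def acrossPerm (D : Diagram) : Equiv.Perm D.Flag where
  toFun := D.across
  invFun q := D.glue (q.1, q.2 + 1)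
  left_inv p := by simp only [across, sub_add_cancel, D.glue_glue]
  right_inv q := by simp only [across, D.glue_glue, add_sub_cancel_right]

open Classical in
/-- Pass through the channel at a shaded corner if its node lies in `U`; all other corners stay
fixed. -/
noncomputable def IsCheckerboard.crossChannel (h : D.IsCheckerboard σ) (U : Set D.Node) :
    Equiv.Perm D.Flag :=
  Function.Involutive.toPerm (fun p => if p ∈ σ ∧ p.1 ∈ U then (p.1, p.2 + 2) else p) <| by
    rintro ⟨x, i⟩
    by_cases hp : (x, i) ∈ σ ∧ x ∈ U
    · have hp' : (x, i + 2) ∈ σ ∧ x ∈ U := ⟨(h.mem_opp x i).2 hp.1, hp.2⟩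
      simp only [if_pos hp, if_pos hp', Prod.mk.injEq, true_and]
      rw [add_assoc]
      exact add_zero i
    · simp only [if_neg hp]

theorem IsCheckerboard.crossChannel_of_mem (h : D.IsCheckerboard σ) {p : D.Flag} (hp : p ∈ σ)
    (hx : p.1 ∈ U) : h.crossChannel U p = (p.1, p.2 + 2) := if_pos ⟨hp, hx⟩

theorem IsCheckerboard.crossChannel_of_not (h : D.IsCheckerboard σ) {p : D.Flag}
    (hp : ¬ (p ∈ σ ∧ p.1 ∈ U)) : h.crossChannel U p = p := if_neg hp

/-- On shaded corners: walk along the shaded side of the circles of the state `U`. -/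
noncomputable def IsCheckerboard.shadedWalk (h : D.IsCheckerboard σ) (U : Set D.Node) :
    Equiv.Perm D.Flag := h.crossChannel U * D.acrossPerm

theorem IsCheckerboard.shadedWalk_of_mem (h : D.IsCheckerboard σ) (U : Set D.Node) {p : D.Flag}
    (hp : p ∈ σ) : h.shadedWalk U p = D.turn σ U (D.glue p) := by
  have hglue : D.glue p ∉ σ := by rwa [h.glue_mem, not_not]
  have hmem : D.acrossPerm p ∈ σ := (h.2 p).2 hp
  rw [shadedWalk, Equiv.Perm.mul_apply]
  by_cases hx : (D.glue p).1 ∈ U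
  · rw [turn_succ (by tauto), h.crossChannel_of_mem hmem hx]
    have e : ∀ i : Fin 4, i - 1 + 2 = i + 1 := by decide
    exact Prod.ext rfl (e _)
  · rw [turn_pred (by tauto), h.crossChannel_of_not (p := D.acrossPerm p) fun h => hx h.2]
    rfl

theorem IsCheckerboard.linked_shadedWalk (h : D.IsCheckerboard σ) (U : Set D.Node) (p : D.Flag) :
    D.Linked σ U p (h.shadedWalk U p) := by
  refine (linked_across p).trans ?_
  change D.Linked σ U (D.across p) (h.crossChannel U (D.across p))
  by_cases hp : D.across p ∈ σ ∧ (D.across p).1 ∈ U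
  · rw [h.crossChannel_of_mem hp.1 hp.2]
    exact linked_opp hp.1 hp.2
  · rw [h.crossChannel_of_not hp]
    exact .refl _

theorem IsCheckerboard.linked_of_sameCycle (h : D.IsCheckerboard σ) {q r : D.Flag}
    (hqr : (h.shadedWalk U).SameCycle q r) : D.Linked σ U q r := by
  obtain ⟨n, rfl⟩ := hqr.exists_nat_pow_eq
  induction n with
  | zero => exact .refl _
  | succ n ih =>
    rw [pow_succ', Equiv.Perm.mul_apply]
    exact (ih ⟨n, by simp⟩).trans (h.linked_shadedWalk U _)

open Classical in
theorem IsCheckerboard.crossChannel_insert (h : D.IsCheckerboard σ) {x : D.Node} {i : Fin 4}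
    (hi : (x, i) ∈ σ) (hx : x ∉ U) :
    h.crossChannel (insert x U) = Equiv.swap (x, i) (x, i + 2) * h.crossChannel U := by
  have hopp : (x, i + 2) ∈ σ := (h.mem_opp x i).2 hi
  ext1 ⟨y, j⟩
  rw [Equiv.Perm.mul_apply]
  by_cases hj : (y, j) ∈ σ
  · by_cases hy : y = x
    · subst hy
      rw [h.crossChannel_of_mem hj (mem_insert _ _), h.crossChannel_of_not fun h => hx h.2]
      rcases h.eq_or_eq_opp hi hj with rfl | rfl
      · rw [Equiv.swap_apply_left]
      · rw [Equiv.swap_apply_right]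
        exact Prod.ext rfl ((by decide : ∀ i : Fin 4, i + 2 + 2 = i) i)
    · have hne : ∀ i j, ((y, j) : D.Flag) ≠ (x, i) := fun _ _ e => hy (congrArg Prod.fst e)
      by_cases hyU : y ∈ U
      · rw [h.crossChannel_of_mem hj (mem_insert_of_mem _ hyU), h.crossChannel_of_mem hj hyU,
          Equiv.swap_apply_of_ne_of_ne (hne _ _) (hne _ _)]
      · rw [h.crossChannel_of_not fun h => hyU (h.2.resolve_left hy),
          h.crossChannel_of_not fun h => hyU h.2,
          Equiv.swap_apply_of_ne_of_ne (hne _ _) (hne _ _)]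
  · rw [h.crossChannel_of_not fun h => hj h.1, h.crossChannel_of_not fun h => hj h.1,
      Equiv.swap_apply_of_ne_of_ne (ne_of_mem_of_not_mem hi hj).symm
        (ne_of_mem_of_not_mem hopp hj).symm]

/-- Each connected component of the surface formed by the shaded regions and the channels at the
nodes in `U` is bounded by a single circle. -/
def IsCheckerboard.BoundsOneCircle (h : D.IsCheckerboard σ) (U : Set D.Node) : Prop :=
  ∀ q r, D.Linked σ U q r → (h.shadedWalk U).SameCycle q r

theorem IsCheckerboard.boundsOneCircle_empty (h : D.IsCheckerboard σ) :
    h.BoundsOneCircle ∅ := by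
  refine fun q r hqr => hqr.induction (R := (h.shadedWalk ∅).SameCycle)
    ⟨.refl _, .symm, .trans⟩ (fun p => ⟨1, ?_⟩) fun _ _ _ hx => hx.elim
  rw [zpow_one, shadedWalk, Equiv.Perm.mul_apply]
  exact h.crossChannel_of_not fun h => h.2

/-- A new channel that joins two components also joins the two circles that bound them. -/
theorem IsCheckerboard.BoundsOneCircle.insert {h : D.IsCheckerboard σ} (hU : h.BoundsOneCircle U)
    {x : D.Node} {i : Fin 4} (hi : (x, i) ∈ σ) (hx : ¬ D.Linked σ U (x, i) (x, i + 2)) :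
    h.BoundsOneCircle (insert x U) := by
  classical
  have hxU : x ∉ U := fun h => hx (linked_opp hi h)
  have hsep : ¬ (h.shadedWalk U).SameCycle (x, i) (x, i + 2) := fun h' =>
    hx (h.linked_of_sameCycle h')
  have hwalk : h.shadedWalk (Insert.insert x U) =
      Equiv.swap (x, i) (x, i + 2) * h.shadedWalk U := by
    rw [shadedWalk, h.crossChannel_insert hi hxU, mul_assoc, ← shadedWalk]
  rw [BoundsOneCircle, hwalk]
  refine fun q r hqr => hqr.induction (R := (_ : Equiv.Perm D.Flag).SameCycle)
    ⟨.refl _, .symm, .trans⟩ (fun p => sameCycle_swap_mul hsep (hU _ _ (linked_across p))) ?_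
  rintro y j hj (rfl | hy)
  · exact h.rel_opp .symm hi hj (sameCycle_swap_mul_self hsep)
  · exact sameCycle_swap_mul hsep (hU _ _ (linked_opp hj hy))

theorem IsCheckerboard.BoundsOneCircle.union {h : D.IsCheckerboard σ} (hU : h.BoundsOneCircle U)
    {S : Set D.Node}
    (hS : ∀ x ∈ S, ∀ i, (x, i) ∈ σ → ¬ D.Linked σ (U ∪ S \ {x}) (x, i) (x, i + 2)) :
    h.BoundsOneCircle (U ∪ S) := by
  induction S, S.toFinite using Set.Finite.induction_on with
  | empty => rwa [union_empty]
  | @insert x S hx _ ih =>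
    obtain ⟨i, hi⟩ := h.exists_mem x
    rw [union_insert]
    refine (ih fun y hy j hj hlink => ?_).insert hi fun hlink => ?_
    · refine hS y (mem_insert_of_mem _ hy) j hj (hlink.mono ?_)
      gcongr
      exact subset_insert _ _
    · refine hS x (mem_insert _ _) i hi (hlink.mono ?_)
      rw [insert_sdiff_of_mem _ (mem_singleton x), sdiff_singleton_eq_self hx]

theorem IsCheckerboard.BoundsOneCircle.oneCircle {h : D.IsCheckerboard σ}
    (hU : h.BoundsOneCircle U) (hconn : D.ShadedConnected σ U) : D.OneCircle σ U := by
  rintro A ⟨p, hp⟩ hglue hturn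
  obtain ⟨q, hq, hqσ⟩ : ∃ q ∈ A, q ∈ σ := by
    by_cases hpσ : p ∈ σ
    exacts [⟨p, hp, hpσ⟩, ⟨_, hglue p hp, (h.glue_mem p).2 hpσ⟩]
  have hshaded : ∀ r ∈ σ, r ∈ A := by
    intro r hr
    obtain ⟨n, rfl⟩ := (hU q r (hconn q hqσ r hr)).exists_nat_pow_eq
    have hn : ∀ n, ((h.shadedWalk U) ^ n) q ∈ A ∩ σ := by
      intro n
      induction n with
      | zero => exact ⟨hq, hqσ⟩
      | succ n ih =>
        rw [pow_succ', Equiv.Perm.mul_apply]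
        refine ⟨?_, (h.mem_of_linked (h.linked_shadedWalk U _)).1 ih.2⟩
        rw [h.shadedWalk_of_mem U ih.2]
        exact hturn _ (hglue _ ih.1)
    exact (hn n).1
  refine eq_univ_of_forall fun r => ?_
  by_cases hr : r ∈ σ
  · exact hshaded r hr
  · rw [← D.glue_glue r]
    exact hglue _ (hshaded _ ((h.glue_mem r).2 hr))

/-! ### Faces and one-circle states -/

/-- The faces of the 4-valent graph formed by the nodes and the arcs, as in `Diagram.IsPlanar`. -/
def Face (D : Diagram) : Type := Quot fun q r : D.Flag => r = D.across q

/-- The face of a corner. -/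
def face (D : Diagram) (q : D.Flag) : D.Face := Quot.mk _ q

instance (D : Diagram) : Finite D.Face := inferInstanceAs (Finite (Quot _))

theorem face_surjective (D : Diagram) : Function.Surjective D.face := Quot.mk_surjective

theorem face_across (q : D.Flag) : D.face (D.across q) = D.face q :=
  (Quot.sound (r := fun q r => r = D.across q) rfl).symm

theorem IsCheckerboard.mem_of_face_eq (h : D.IsCheckerboard σ) {q r : D.Flag}
    (hqr : D.face q = D.face r) : q ∈ σ ↔ r ∈ σ := by
  refine iff_of_eq (congrArg (Quot.lift (· ∈ σ) ?_) hqr)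
  rintro q _ rfl
  exact propext (h.2 q).symm

theorem IsCheckerboard.card_face (h : D.IsCheckerboard σ) :
    Nat.card D.Face = (D.face '' σ).ncard + (D.face '' σᶜ).ncard := by
  rw [← ncard_univ, ← ncard_union_eq, ← image_union, union_compl_self, image_univ,
    D.face_surjective.range_eq]
  rw [disjoint_left]
  rintro _ ⟨q, hq, rfl⟩ ⟨r, hr, hrq⟩
  exact hr ((h.mem_of_face_eq hrq).2 hq)

theorem ShadedConnected.ncard_shadedFaces_le (h : D.IsCheckerboard σ)
    (hU : D.ShadedConnected σ U) : (D.face '' σ).ncard ≤ U.ncard + 1 := by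
  choose i hi using h.exists_mem
  refine card_le_card_add_one_of_forall_eq_univ (ι := U)
    (fun x => ⟨D.face (x, i x), mem_image_of_mem _ (hi x)⟩)
    (fun x => ⟨D.face (x, i x + 2), mem_image_of_mem _ ((h.mem_opp _ _).2 (hi x))⟩) ?_
  rintro S ⟨⟨_, q, hq, rfl⟩, hqS⟩ hS
  set T : Set D.Face := Subtype.val '' S
  have hT : ∀ v : D.face '' σ, (v : D.Face) ∈ T ↔ v ∈ S := fun v =>
    Subtype.val_injective.mem_set_image
  refine eq_univ_of_forall ?_
  rintro ⟨_, r, hr, rfl⟩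
  refine (hT _).1 (((hU q hq r hr).induction (R := fun q r => D.face q ∈ T ↔ D.face r ∈ T)
    ⟨fun _ => .rfl, .symm, .trans⟩ (fun p => by rw [face_across]) ?_).1 ((hT _).2 hqS))
  intro x j hj hx
  exact h.rel_opp (R := fun q r => D.face q ∈ T ↔ D.face r ∈ T) .symm (hi x) hj
    ((hT _).trans ((hS ⟨x, hx⟩).trans (hT _).symm))

theorem OneCircle.ncard_shadedFaces (h : D.IsCheckerboard σ)
    (hF : Nat.card D.Node + 2 ≤ Nat.card D.Face) (hU : D.OneCircle σ U) :
    (D.face '' σ).ncard = U.ncard + 1 := by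
  have hle := (hU.shadedConnected h).ncard_shadedFaces_le h
  have hle' := ((oneCircle_compl.2 hU).shadedConnected h.compl).ncard_shadedFaces_le h.compl
  have hcard := h.card_face
  have hnode := ncard_add_ncard_compl U
  omega

theorem ShadedConnected.diff_singleton (h : D.IsCheckerboard σ) (hU : D.ShadedConnected σ U)
    {x : D.Node} {i : Fin 4} (hi : (x, i) ∈ σ)
    (hlink : D.Linked σ (U \ {x}) (x, i) (x, i + 2)) : D.ShadedConnected σ (U \ {x}) := by
  refine fun q hq r hr => (hU q hq r hr).induction ⟨.refl, .symm, .trans⟩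
    linked_across fun y j hj hy => ?_
  by_cases hyx : y = x
  · subst hyx
    exact h.rel_opp .symm hi hj hlink
  · exact linked_opp hj ⟨hy, hyx⟩

/-- On a sphere there are just enough channels in a one-circle state to connect the shaded
faces, so that each of them is a bridge. -/
theorem OneCircle.not_linked (h : D.IsCheckerboard σ)
    (hF : Nat.card D.Node + 2 ≤ Nat.card D.Face) (hU : D.OneCircle σ U) {x : D.Node} (hx : x ∈ U)
    {i : Fin 4} (hi : (x, i) ∈ σ) : ¬ D.Linked σ (U \ {x}) (x, i) (x, i + 2) := by
  intro hlink
  have hle := ((hU.shadedConnected h).diff_singleton h hi hlink).ncard_shadedFaces_le h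
  rw [hU.ncard_shadedFaces h hF, ncard_sdiff_singleton_of_mem hx] at hle
  have := (ncard_pos (toFinite U)).2 ⟨x, hx⟩
  omega

/-! ### Spanning trees of the Tait graph -/

/-- The smoothed nodes at which the shaded corners have been merged. -/
def shadedSmoothings (D : Diagram) (σ : Set D.Flag) : Set D.Node :=
  {x | D.elem x = .vert ∧ (x, 0) ∈ σ ∨ D.elem x = .horiz ∧ (x, 1) ∈ σ}

theorem not_isCrossing_of_mem_shadedSmoothings {x : D.Node} (hx : x ∈ D.shadedSmoothings σ) :
    ¬ (D.elem x).IsCrossing := by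
  rcases hx with ⟨hx, -⟩ | ⟨hx, -⟩ <;> simp [hx, Elem.IsCrossing]

theorem eq_opp_of_cornersJoined {x : D.Node} {i j : Fin 4}
    (hij : (D.elem x).CornersJoined i j) :
    j = i + 2 ∧ ((x, i) ∈ σ → x ∈ D.shadedSmoothings σ) := by
  rcases hx : D.elem x with - | - | - | - <;> rw [hx] at hij
  · exact hij.elim
  · exact hij.elim
  · obtain ⟨rfl, rfl⟩ := hij
    exact ⟨rfl, fun hi => .inl ⟨hx, hi⟩⟩
  · obtain ⟨rfl, rfl⟩ := hij
    exact ⟨rfl, fun hi => .inr ⟨hx, hi⟩⟩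

theorem IsCheckerboard.region_opp (h : D.IsCheckerboard σ) {x : D.Node} {i : Fin 4}
    (hi : (x, i) ∈ σ) (hx : x ∈ D.shadedSmoothings σ) :
    D.region (x, i) = D.region (x, i + 2) := by
  rcases hx with ⟨hx, h0⟩ | ⟨hx, h1⟩
  · exact h.rel_opp (R := fun q r => D.region q = D.region r) .symm h0 hi <|
      Quot.sound (.inr ⟨rfl, by rw [hx]; exact ⟨rfl, rfl⟩⟩)
  · exact h.rel_opp (R := fun q r => D.region q = D.region r) .symm h1 hi <|
      Quot.sound (.inr ⟨rfl, by rw [hx]; exact ⟨rfl, rfl⟩⟩)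

theorem region_across (q : D.Flag) : D.region q = D.region (D.across q) := Quot.sound (.inl rfl)

theorem IsCheckerboard.linked_of_region_eq (h : D.IsCheckerboard σ) {q r : D.Flag} (hq : q ∈ σ)
    (hqr : D.region q = D.region r) : D.Linked σ (D.shadedSmoothings σ) q r := by
  have hR : Equivalence fun q r =>
      (q ∈ σ ↔ r ∈ σ) ∧ (q ∈ σ → D.Linked σ (D.shadedSmoothings σ) q r) :=
    ⟨fun q => ⟨.rfl, fun _ => .refl q⟩, fun H => ⟨H.1.symm, fun hr => (H.2 (H.1.2 hr)).symm⟩,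
      fun H H' => ⟨H.1.trans H'.1, fun hq => (H.2 hq).trans (H'.2 (H.1.1 hq))⟩⟩
  refine (hR.eqvGen_iff.1 (EqvGen.mono ?_ _ _ (Quot.eqvGen_exact hqr))).2 hq
  rintro ⟨x, i⟩ r (rfl | ⟨rfl, hij⟩)
  · exact ⟨(h.2 _).symm, fun _ => linked_across _⟩
  · obtain ⟨hr, hx⟩ := eq_opp_of_cornersJoined (σ := σ) hij
    rw [show r = (r.1, i + 2) from Prod.ext rfl hr]
    exact ⟨(h.mem_opp _ i).symm, fun hi => linked_opp hi (hx hi)⟩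

theorem IsCheckerboard.isLink_iff (h : D.IsCheckerboard σ) {x : D.Node} {i : Fin 4}
    (hi : (x, i) ∈ σ) :
    (D.taitGraph σ).IsLink x (D.region (x, i)) (D.region (x, i + 2)) ↔ (D.elem x).IsCrossing :=
  ⟨And.left, fun hx => ⟨hx, i, hi, (h.mem_opp x i).2 hi, fun _ => h.eq_or_eq_opp hi, rfl, rfl⟩⟩

theorem IsCheckerboard.reflTransGen_of_linked (h : D.IsCheckerboard σ) {S : Set D.Node}
    (hS : ∀ x ∈ S, (D.elem x).IsCrossing) {q r : D.Flag}
    (hqr : D.Linked σ (D.shadedSmoothings σ ∪ S) q r) :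
    ReflTransGen (fun u v => ∃ e ∈ S, (D.taitGraph σ).IsLink e u v) (D.region q) (D.region r) := by
  set P := fun u v => ∃ e ∈ S, (D.taitGraph σ).IsLink e u v
  have hP : Std.Symm P := ⟨fun u v ⟨e, he, huv⟩ => ⟨e, he, huv.symm⟩⟩
  refine hqr.induction (R := fun q r => ReflTransGen P (D.region q) (D.region r))
    ⟨fun _ => .refl, Std.Symm.symm _ _, .trans⟩ (fun p => ?_) ?_
  · rw [region_across]
  · rintro x i hi (hx | hx)
    · rw [h.region_opp hi hx]
    · exact .single ⟨x, hx, (h.isLink_iff hi).2 (hS x hx)⟩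

theorem IsCheckerboard.linked_of_reflTransGen (h : D.IsCheckerboard σ) {S : Set D.Node}
    {q r : D.Flag} (hq : q ∈ σ) (hqr : ReflTransGen
      (fun u v => ∃ e ∈ S, (D.taitGraph σ).IsLink e u v) (D.region q) (D.region r)) :
    D.Linked σ (D.shadedSmoothings σ ∪ S) q r := by
  have hmono : ∀ {q r}, q ∈ σ → D.region q = D.region r →
      D.Linked σ (D.shadedSmoothings σ ∪ S) q r := fun hq hqr =>
    (h.linked_of_region_eq hq hqr).mono subset_union_left
  suffices H : ∃ s ∈ σ, D.region s = D.region r ∧ D.Linked σ (D.shadedSmoothings σ ∪ S) q s by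
    obtain ⟨s, hs, hsr, hqs⟩ := H
    exact hqs.trans (hmono hs hsr)
  generalize D.region r = v at hqr
  induction hqr with
  | refl => exact ⟨q, hq, rfl, .refl q⟩
  | tail _ huv ih =>
    obtain ⟨s, hs, rfl, hqs⟩ := ih
    obtain ⟨x, hx, -, i, hi, hi', -, hsi, rfl⟩ := huv
    exact ⟨_, hi', rfl, (hqs.trans (hmono hs hsi.symm)).trans (linked_opp hi (.inr hx))⟩

theorem ShadedConnected.exists_oneCircle (h : D.IsCheckerboard σ) (hU : D.ShadedConnected σ U) :
    ∃ T ⊆ U, D.OneCircle σ T := by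
  obtain ⟨T, hTU, hT⟩ := exists_minimal_le_of_wellFoundedLT (D.ShadedConnected σ) U hU
  have hbound : h.BoundsOneCircle (∅ ∪ T) := h.boundsOneCircle_empty.union fun x hx i hi hlink => by
    rw [empty_union] at hlink
    exact (hT.le_of_le (hT.prop.diff_singleton h hi hlink) sdiff_subset hx).2 rfl
  rw [empty_union] at hbound
  exact ⟨T, hTU, hbound.oneCircle hT.prop⟩

theorem IsCheckerboard.portsJoined_iff (h : D.IsCheckerboard σ) {x : D.Node}
    (hx : ¬ (D.elem x).IsCrossing) (hU : x ∈ U ↔ x ∈ D.shadedSmoothings σ) (i j : Fin 4) :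
    (D.elem x).PortsJoined i j ↔ j = i ∨ (x, j) = D.turn σ U (x, i) := by
  have h1 : (x, 1) ∈ σ ↔ (x, 0) ∉ σ := h.mem_succ x 0
  have h2 : (x, 2) ∈ σ ↔ (x, 0) ∈ σ := h.mem_opp x 0
  have h3 : (x, 3) ∈ σ ↔ (x, 1) ∈ σ := h.mem_opp x 1
  rcases he : D.elem x with - | - | - | -
  · exact absurd (.inl he) hx
  · exact absurd (.inr he) hx
  · have hU0 : x ∈ U ↔ (x, 0) ∈ σ := by simpa [shadedSmoothings, he] using hU
    have hturn : D.turn σ U (x, i) = (x, 3 - i) := by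
      fin_cases i <;> simp [turn, hU0, h1, h2, h3]; rfl
    simp [hturn, Elem.PortsJoined]
  · have hU1 : x ∈ U ↔ (x, 1) ∈ σ := by simpa [shadedSmoothings, he] using hU
    have hturn : D.turn σ U (x, i) = (x, 1 - i) := by
      fin_cases i <;> simp [turn, hU1, h1, h2, h3]
    simp [hturn, Elem.PortsJoined]

/-- At each smoothed node the state `U` uses the smoothing that the diagram shows. -/
def ExtendsSmoothings (D : Diagram) (σ : Set D.Flag) (U : Set D.Node) : Prop :=
  ∀ x, ¬ (D.elem x).IsCrossing → (x ∈ U ↔ x ∈ D.shadedSmoothings σ)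

theorem OneCircle.isConnected (h : D.IsCheckerboard σ) (hU : D.OneCircle σ U)
    (hE : D.ExtendsSmoothings σ U) : D.IsConnected := by
  refine fun p => eq_univ_iff_forall.1 (hU {q | ReflTransGen _ p q} ⟨p, .refl⟩
    (fun q hq => hq.tail (.inl rfl)) fun q hq => hq.tail (.inr ?_))
  refine ⟨(turn_fst q).symm, ?_⟩
  by_cases hx : (D.elem q.1).IsCrossing
  · rcases hx with hx | hx <;> simp [hx, Elem.PortsJoined]
  · exact (h.portsJoined_iff hx (hE _ hx) _ _).2 (.inr (Prod.ext (turn_fst q).symm rfl))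

theorem IsConnected.shadedConnected_compl (h : D.IsCheckerboard σ) (hD : D.IsConnected) :
    D.ShadedConnected σᶜ (D.shadedSmoothings σ)ᶜ := by
  intro q hq r hr
  rw [← shadedSide_of_mem hq, ← shadedSide_of_mem hr]
  clear hr
  induction hD q r with
  | refl => exact .refl _
  | @tail p r _ hpr ih =>
    refine ih.trans ?_
    obtain rfl | ⟨hx, hij⟩ := hpr
    · exact h.compl.linked_shadedSide_glue _ p
    obtain ⟨x, i⟩ := p
    obtain ⟨y, j⟩ := r
    obtain rfl : x = y := hx
    by_cases hM : x ∈ D.shadedSmoothings σ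
    · rcases (h.portsJoined_iff (not_isCrossing_of_mem_shadedSmoothings hM) .rfl i j).1 hij with
        rfl | e
      · exact .refl _
      · rw [e, ← turn_compl]
        exact h.compl.linked_shadedSide_turn _ _
    · exact h.compl.linked_shadedSide hM i j

/-- The channels at the smoothed nodes can be completed to a one-circle state, so none of them
closes a cycle. -/
theorem IsConnected.boundsOneCircle_shadedSmoothings (h : D.IsCheckerboard σ)
    (hF : Nat.card D.Node + 2 ≤ Nat.card D.Face) (hD : D.IsConnected) :
    h.BoundsOneCircle (D.shadedSmoothings σ) := by
  obtain ⟨T, hT, hone⟩ := (hD.shadedConnected_compl h).exists_oneCircle h.compl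
  have hone' : D.OneCircle σ Tᶜ := by rwa [← oneCircle_compl, compl_compl]
  have hsub : D.shadedSmoothings σ ⊆ Tᶜ := subset_compl_comm.1 hT
  rw [← empty_union (D.shadedSmoothings σ)]
  refine h.boundsOneCircle_empty.union fun x hx i hi hlink =>
    hone'.not_linked h hF (hsub hx) hi (hlink.mono ?_)
  rw [empty_union]
  exact sdiff_subset_sdiff_left hsub

theorem isSpanningTree_iff (h : D.IsCheckerboard σ) (hF : Nat.card D.Node + 2 ≤ Nat.card D.Face)
    (hD : D.IsConnected) {S : Set D.Node} :
    (D.taitGraph σ).IsSpanningTree S ↔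
      (∀ x ∈ S, (D.elem x).IsCrossing) ∧ D.OneCircle σ (D.shadedSmoothings σ ∪ S) := by
  constructor
  · rintro ⟨hedge, hconn, hacyclic⟩
    have hS : ∀ x ∈ S, (D.elem x).IsCrossing := by
      intro x hx
      obtain ⟨u, v, huv⟩ := hedge hx
      exact huv.1
    have hbound := (hD.boundsOneCircle_shadedSmoothings h hF).union fun x hx i hi hlink =>
      hacyclic x hx _ _ ((h.isLink_iff hi).2 (hS x hx))
        (h.reflTransGen_of_linked (fun y hy => hS y hy.1) hlink)
    exact ⟨hS, hbound.oneCircle fun q hq r hr =>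
      h.linked_of_reflTransGen hq (hconn _ ⟨q, hq, rfl⟩ _ ⟨r, hr, rfl⟩)⟩
  · rintro ⟨hS, hone⟩
    refine ⟨fun x hx => ?_, ?_, ?_⟩
    · obtain ⟨i, hi⟩ := h.exists_mem x
      exact ⟨_, _, (h.isLink_iff hi).2 (hS x hx)⟩
    · rintro _ ⟨q, hq, rfl⟩ _ ⟨r, hr, rfl⟩
      exact h.reflTransGen_of_linked hS (hone.shadedConnected h q hq r hr)
    · rintro x hx _ _ ⟨-, i, hi, -, -, rfl, rfl⟩ hpath
      have hM : x ∉ D.shadedSmoothings σ := fun hM =>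
        not_isCrossing_of_mem_shadedSmoothings hM (hS x hx)
      refine hone.not_linked h hF (.inr hx) hi ((h.linked_of_reflTransGen hi hpath).mono ?_)
      rw [union_sdiff_distrib, sdiff_singleton_eq_self hM]

theorem IsCheckerboard.mem_iff_mem_iff (h : D.IsCheckerboard σ) {τ : Set D.Flag}
    (hτ : D.IsCheckerboard τ) (x : D.Node) (i j : Fin 4) :
    ((x, i) ∈ τ ↔ (x, i) ∈ σ) ↔ ((x, j) ∈ τ ↔ (x, j) ∈ σ) := by
  rcases fin_four_cases i j with rfl | rfl | rfl | rfl
  · rfl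
  · rw [h.mem_pred, hτ.mem_pred, not_iff_not]
  · rw [h.mem_succ, hτ.mem_succ, not_iff_not]
  · rw [h.mem_opp, hτ.mem_opp]

theorem IsConnected.eq_or_eq_compl (hD : D.IsConnected) (h : D.IsCheckerboard σ) {τ : Set D.Flag}
    (hτ : D.IsCheckerboard τ) : τ = σ ∨ τ = σᶜ := by
  have hagree : ∀ p q, (p ∈ τ ↔ p ∈ σ) ↔ (q ∈ τ ↔ q ∈ σ) := by
    intro p q
    induction hD p q with
    | refl => rfl
    | @tail b c _ hbc ih =>
      refine ih.trans ?_
      rcases hbc with rfl | ⟨hx, -⟩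
      · rw [h.glue_mem, hτ.glue_mem, not_iff_not]
      · obtain ⟨x, i⟩ := b
        obtain ⟨y, j⟩ := c
        obtain rfl : x = y := hx
        exact h.mem_iff_mem_iff hτ x i j
  by_cases hp : ∃ p, p ∈ τ ↔ p ∈ σ
  · obtain ⟨p, hp⟩ := hp
    exact .inl (Set.ext fun q => (hagree p q).1 hp)
  · push Not at hp
    exact .inr (Set.ext fun q => by rw [mem_compl_iff]; have := hp q; tauto)

end Diagram

/-! ### The determinant as a state sum -/

theorem sum_neg_one_pow_mul_ncard {ι : Type*} [Fintype ι] (p : ι → Prop) [DecidablePred p]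
    (f : ι → ℕ) {n : ℕ} (hf : ∀ i, f i ≤ n) :
    ∑ v ∈ Finset.range (n + 1), (-1 : ℤ) ^ v * ({i | p i ∧ f i = v}.ncard : ℤ) =
      ∑ i with p i, (-1) ^ f i := by
  rw [← Finset.sum_fiberwise_of_maps_to (g := f) (t := Finset.range (n + 1))
    fun i _ => Finset.mem_range.2 (Nat.lt_succ_of_le (hf i))]
  refine Finset.sum_congr rfl fun v _ => ?_
  rw [Finset.sum_congr rfl (g := fun _ => (-1 : ℤ) ^ v)
    fun i hi => by rw [(Finset.mem_filter.1 hi).2], Finset.sum_const, nsmul_eq_mul, mul_comm,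
    Finset.filter_filter, Set.ncard_eq_toFinset_card']
  congr 3
  ext i
  simp

theorem prod_ite_neg_one {ι : Type*} [Fintype ι] (p : ι → Prop) [DecidablePred p] :
    ∏ i, (if p i then (-1 : ℤ) else 1) = (-1) ^ {i | p i}.ncard := by
  rw [Finset.prod_ite, Finset.prod_const_one, mul_one, Finset.prod_const,
    Set.ncard_eq_toFinset_card']
  congr 2
  ext i
  simp

theorem sum_eq_sum_of_sum_update_eq {ι α M : Type*} [Fintype ι] [DecidableEq ι] [Fintype α]
    [AddCommMonoid M] {F G : (ι → α) → M} (c : ι)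
    (h : ∀ s, ∑ v, F (Function.update s c v) = ∑ v, G (Function.update s c v)) :
    ∑ s, F s = ∑ s, G s := by
  rcases isEmpty_or_nonempty α with _ | ⟨⟨v₀⟩⟩
  · have : IsEmpty (ι → α) := ⟨fun s => isEmptyElim (s c)⟩
    rw [Fintype.sum_empty, Fintype.sum_empty]
  have hsplit : ∀ H : (ι → α) → M, ∑ s, H s = ∑ r : {x // x ≠ c} → α,
      ∑ v, H (Function.update ((Equiv.funSplitAt c α).symm (v₀, r)) c v) := fun H => by
    rw [← (Equiv.funSplitAt c α).symm.sum_comp, Fintype.sum_prod_type_right]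
    refine Finset.sum_congr rfl fun r _ => Finset.sum_congr rfl fun v _ => congrArg H ?_
    ext x
    by_cases hx : x = c
    · subst hx; simp
    · simp [hx]
  simp only [hsplit, h]

/-- The contribution of a node drawn as `e` to the signed count of spanning trees, written as a
weight on its two smoothings: `u` says whether the shaded corners are merged, and `b` says whether
the shaded corners are W and E.  A smoothed node allows only the smoothing that it shows. -/
def Elem.weight (e : Elem) (b u : Bool) : ℤ :=
  match e with
  | .pos => if u = true ∧ b = true then -1 else 1
  | .neg => if u = true ∧ b = false then -1 else 1
  | .vert => if u = b then 0 else 1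
  | .horiz => if u = b then 1 else 0

theorem Elem.exists_weight_not (e : Elem) (b : Bool) : ∃ ε : ℤ, |ε| = 1 ∧
    ∀ u, e.weight (!b) (!u) = ε * (if u = true then -1 else 1) * e.weight b u := by
  rcases e <;> cases b <;>
    first | exact ⟨1, by simp, by decide⟩ | exact ⟨-1, by simp, by decide⟩

namespace Diagram

open Relation Set

variable {D : Diagram} {σ : Set D.Flag} {U : Set D.Node}

open Classical in
/-- The sum, over the Kauffman states with a single circle, of the products of the weights that
`W` gives to the smoothings; `s x = true` means that the shaded corners of `x` are merged. -/
noncomputable def stateSum (D : Diagram) (σ : Set D.Flag) (W : D.Node → Bool → ℤ) : ℤ :=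
  ∑ s : D.Node → Bool, if D.OneCircle σ {x | s x = true} then ∏ x, W x (s x) else 0

open Classical in
/-- The weights for which the state sum is the signed count of spanning trees. -/
noncomputable def nodeWeight (D : Diagram) (σ : Set D.Flag) (x : D.Node) : Bool → ℤ :=
  (D.elem x).weight (decide ((x, 1) ∈ σ))

theorem IsPositiveEdge.isCrossing {x : D.Node} (hx : D.IsPositiveEdge σ x) :
    (D.elem x).IsCrossing := hx.imp And.left And.left

open Classical in
theorem nodeWeight_of_isCrossing (h : D.IsCheckerboard σ) {x : D.Node}
    (hx : (D.elem x).IsCrossing) (u : Bool) :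
    D.nodeWeight σ x u = if u = true ∧ D.IsPositiveEdge σ x then -1 else 1 := by
  have h1 : (x, 1) ∈ σ ↔ (x, 0) ∉ σ := h.mem_succ x 0
  rcases hx with hx | hx <;> simp [nodeWeight, Elem.weight, IsPositiveEdge, hx, h1]

open Classical in
theorem nodeWeight_of_not_isCrossing (h : D.IsCheckerboard σ) {x : D.Node}
    (hx : ¬ (D.elem x).IsCrossing) (u : Bool) :
    D.nodeWeight σ x u = if u = true ↔ x ∈ D.shadedSmoothings σ then 1 else 0 := by
  have h1 : (x, 1) ∈ σ ↔ (x, 0) ∉ σ := h.mem_succ x 0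
  rcases he : D.elem x with - | - | - | -
  · exact (hx (.inl he)).elim
  · exact (hx (.inr he)).elim
  all_goals
    by_cases h0 : (x, 0) ∈ σ <;> cases u <;>
      simp [nodeWeight, Elem.weight, shadedSmoothings, he, h0, h1]

open Classical in
theorem prod_nodeWeight (h : D.IsCheckerboard σ) (s : D.Node → Bool) :
    ∏ x, D.nodeWeight σ x (s x) = if D.ExtendsSmoothings σ {x | s x = true} then
      (-1) ^ {x | s x = true ∧ D.IsPositiveEdge σ x}.ncard else 0 := by
  split_ifs with hE
  · rw [← prod_ite_neg_one]
    refine Finset.prod_congr rfl fun x _ => ?_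
    by_cases hx : (D.elem x).IsCrossing
    · rw [nodeWeight_of_isCrossing h hx]
    · have hs : s x = true ↔ x ∈ D.shadedSmoothings σ := hE x hx
      rw [nodeWeight_of_not_isCrossing h hx, if_pos hs, if_neg fun h => hx h.2.isCrossing]
  · simp only [ExtendsSmoothings, not_forall] at hE
    obtain ⟨x, hx, hxU⟩ := hE
    exact Finset.prod_eq_zero (Finset.mem_univ x)
      ((nodeWeight_of_not_isCrossing h hx _).trans (if_neg hxU))

theorem extendsSmoothings_union {S : Set D.Node} (hS : ∀ x ∈ S, (D.elem x).IsCrossing) :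
    D.ExtendsSmoothings σ (D.shadedSmoothings σ ∪ S) :=
  fun x hx => or_iff_left fun hxS => hx (hS x hxS)

theorem ExtendsSmoothings.union_crossings (hU : D.ExtendsSmoothings σ U) :
    D.shadedSmoothings σ ∪ {x ∈ U | (D.elem x).IsCrossing} = U := by
  ext x
  by_cases hx : (D.elem x).IsCrossing
  · have : x ∉ D.shadedSmoothings σ := fun h => not_isCrossing_of_mem_shadedSmoothings h hx
    simp [this, hx]
  · simp [hU x hx, hx]

theorem crossings_union {S : Set D.Node} (hS : ∀ x ∈ S, (D.elem x).IsCrossing) :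
    {x ∈ D.shadedSmoothings σ ∪ S | (D.elem x).IsCrossing} = S := by
  ext x
  refine ⟨fun hx => hx.1.resolve_left fun h => not_isCrossing_of_mem_shadedSmoothings h hx.2,
    fun hx => ⟨.inr hx, hS x hx⟩⟩

theorem treeSum_eq_stateSum (h : D.IsCheckerboard σ) (hF : Nat.card D.Node + 2 ≤ Nat.card D.Face)
    (hD : D.IsConnected) : D.treeSum σ = D.stateSum σ (D.nodeWeight σ) := by
  classical
  have htree := fun S => isSpanningTree_iff h hF hD (S := S)
  have hunion : ∀ s : D.Node → Bool, D.ExtendsSmoothings σ {x | s x = true} →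
      D.shadedSmoothings σ ∪ {x | s x = true ∧ (D.elem x).IsCrossing} = {x | s x = true} :=
    fun _ => ExtendsSmoothings.union_crossings
  simp only [treeSum, treeCount]
  rw [sum_neg_one_pow_mul_ncard _ _ fun S => ncard_le_card _]
  simp only [stateSum, prod_nodeWeight h, ← ite_and, ← Finset.sum_filter]
  refine Finset.sum_nbij' (fun S x => decide (x ∈ D.shadedSmoothings σ ∪ S))
    (fun s => {x | s x = true ∧ (D.elem x).IsCrossing}) ?_ ?_ ?_ ?_ ?_
  · simp only [Finset.mem_filter_univ, decide_eq_true_eq, ofPred_mem_eq, htree]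
    exact fun S hS => ⟨hS.2, extendsSmoothings_union hS.1⟩
  · simp only [Finset.mem_filter_univ, htree]
    rintro s ⟨hone, hE⟩
    exact ⟨fun x hx => hx.2, by rwa [hunion s hE]⟩
  · simp only [Finset.mem_filter_univ, decide_eq_true_eq, htree]
    exact fun S hS => crossings_union hS.1
  · simp only [Finset.mem_filter_univ]
    rintro s ⟨-, hE⟩
    ext x
    simp only [hunion s hE, mem_ofPred, Bool.decide_eq_true]
  · simp only [Finset.mem_filter_univ, decide_eq_true_eq, htree]
    intro S hS
    congr 2
    conv_lhs => rw [← crossings_union (σ := σ) hS.1]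
    ext x
    exact ⟨fun hx => ⟨hx.1.1, hx.2⟩, fun hx => ⟨⟨hx.1, hx.2.isCrossing⟩, hx.2⟩⟩

theorem stateSum_eq_zero (h : D.IsCheckerboard σ) (hD : ¬ D.IsConnected) :
    D.stateSum σ (D.nodeWeight σ) = 0 := by
  classical
  refine Finset.sum_eq_zero fun s _ => ite_eq_right_iff.2 fun hs => ?_
  rw [prod_nodeWeight h, if_neg fun hE => hD (hs.isConnected h hE)]

theorem abs_stateSum_compl (h : D.IsCheckerboard σ)
    (hF : Nat.card D.Node + 2 ≤ Nat.card D.Face) :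
    |D.stateSum σᶜ (D.nodeWeight σᶜ)| = |D.stateSum σ (D.nodeWeight σ)| := by
  classical
  choose ε hε hweight using fun x => (D.elem x).exists_weight_not (decide ((x, 1) ∈ σ))
  have hnode : ∀ x u, D.nodeWeight σᶜ x (!u) =
      ε x * (if u = true then -1 else 1) * D.nodeWeight σ x u := fun x u => by
    rw [nodeWeight, nodeWeight, ← hweight]
    simp
  suffices D.stateSum σᶜ (D.nodeWeight σᶜ) =
      (∏ x, ε x) * (-1) ^ ((D.face '' σ).ncard - 1) * D.stateSum σ (D.nodeWeight σ) by
    rw [this, abs_mul, abs_mul, abs_pow, Finset.abs_prod, Finset.prod_congr rfl fun x _ => hε x]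
    simp
  rw [stateSum, stateSum, Finset.mul_sum]
  refine Fintype.sum_bijective (fun s x => !(s x))
    (Function.Involutive.bijective fun s => by simp) _ _ fun s => ?_
  have hiff : D.OneCircle σᶜ {x | s x = true} ↔ D.OneCircle σ {x | (!(s x)) = true} := by
    rw [← oneCircle_compl (σ := σ)]
    congr! 1
    ext x
    simp
  rw [mul_ite, mul_zero]
  refine if_ctx_congr hiff (fun hone => ?_) fun _ => rfl
  rw [hone.ncard_shadedFaces h hF, Nat.add_sub_cancel, ← prod_ite_neg_one,
    ← Finset.prod_mul_distrib, ← Finset.prod_mul_distrib]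
  exact Finset.prod_congr rfl fun x _ => by simpa using hnode x (!(s x))

theorem det_eq_abs_stateSum (h : D.IsCheckerboard σ)
    (hF : Nat.card D.Node + 2 ≤ Nat.card D.Face) :
    (D.det : ℤ) = |D.stateSum σ (D.nodeWeight σ)| := by
  unfold det
  by_cases hD : D.IsConnected
  · have hex : D.IsConnected ∧ ∃ σ, D.IsCheckerboard σ := ⟨hD, σ, h⟩
    have hτ := hex.2.choose_spec
    rw [dif_pos hex, Int.natCast_natAbs, treeSum_eq_stateSum hτ hF hD]
    rcases hD.eq_or_eq_compl h hτ with e | e <;> rw [e]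
    exact abs_stateSum_compl h hF
  · rw [dif_neg fun hex => hD hex.1, stateSum_eq_zero h hD]
    rfl

end Diagram

/-! ### Fusing adjacent nodes -/

namespace Diagram

open Set

variable {D : Diagram} {σ : Set D.Flag} {U : Set D.Node} {c : D.Node} {k : Fin 4} {e : Elem}

/-- The colouring of the enlarged diagram: the new node is shaded like the node it is put beside. -/
def attachColor (D : Diagram) (σ : Set D.Flag) (c : D.Node) (k : Fin 4) (e : Elem) :
    Set (D.attach c k e).Flag :=
  {p : Option D.Node × Fin 4 | (p.1.getD c, p.2) ∈ σ}

theorem attachPort_getD (D : Diagram) (c : D.Node) (k : Fin 4) (p : D.Flag) :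
    (D.attachPort c k p).1.getD c = p.1 := by
  unfold attachPort
  split_ifs with h
  · exact h.1.symm
  · rfl

theorem attachPort_snd (D : Diagram) (c : D.Node) (k : Fin 4) (p : D.Flag) :
    (D.attachPort c k p).2 = p.2 := by
  unfold attachPort
  split_ifs <;> rfl

theorem attachPort_of_ne {x : D.Node} (hx : x ≠ c) (j : Fin 4) :
    D.attachPort c k (x, j) = (some x, j) :=
  if_neg fun h => hx h.1

theorem attachPort_none {j : Fin 4} (hj : j = k ∨ j = k + 1) :
    D.attachPort c k (c, j) = (none, j) :=
  if_pos ⟨rfl, hj⟩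

theorem attachPort_some {j : Fin 4} (hj : j = k - 1 ∨ j = k + 2) :
    D.attachPort c k (c, j) = (some c, j) :=
  have : ∀ k j : Fin 4, j = k - 1 ∨ j = k + 2 → ¬ (j = k ∨ j = k + 1) := by decide
  if_neg fun h => this k j hj h.2

theorem IsCheckerboard.attach (h : D.IsCheckerboard σ) (c : D.Node) (k : Fin 4) (e : Elem) :
    (D.attach c k e).IsCheckerboard (D.attachColor σ c k e) := by
  refine ⟨fun x i => h.1 _ i, fun q => ?_⟩
  obtain ⟨e1, e2, e3, e4⟩ := D.attachGlue_inner c k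
  change ((D.attachGlue c k q).1.getD c, (D.attachGlue c k q).2 - 1) ∈ σ ↔ (q.1.getD c, q.2) ∈ σ
  rcases D.attach_cases c k q with ⟨p, rfl⟩ | rfl | rfl | rfl | rfl
  · simp only [attachGlue_attachPort, attachPort_getD, attachPort_snd]
    exact h.2 p
  · simp only [e1, Option.getD]
  · simp only [e2, Option.getD, h.mem_opp, add_sub_cancel_right]
  · simp only [e3, Option.getD, (by decide : ∀ k : Fin 4, k - 1 - 1 = k + 2), h.mem_opp]
  · simp only [e4, Option.getD, (by decide : ∀ k : Fin 4, k + 2 - 1 = k + 1)]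

theorem card_attach (D : Diagram) (c : D.Node) (k : Fin 4) (e : Elem) :
    Nat.card (D.attach c k e).Node = Nat.card D.Node + 1 :=
  have := D.finite
  Finite.card_option

theorem IsCheckerboard.turn_cap (h : D.IsCheckerboard σ) {x : D.Node} (hx : (x, k) ∈ σ ↔ x ∉ U) :
    D.turn σ U (x, k) = (x, k + 1) ∧ D.turn σ U (x, k + 1) = (x, k) ∧
    D.turn σ U (x, k + 2) = (x, k - 1) ∧ D.turn σ U (x, k - 1) = (x, k + 2) := by
  have t1 := turn_succ hx
  have t3 : D.turn σ U (x, k + 2) = (x, k + 2 + 1) := turn_succ ((h.mem_opp x k).trans hx)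
  rw [(by decide : ∀ k : Fin 4, k + 2 + 1 = k - 1) k] at t3
  exact ⟨t1, by rw [← t1, h.turn_turn], t3, by rw [← t3, h.turn_turn]⟩

theorem IsCheckerboard.turn_through (h : D.IsCheckerboard σ) {x : D.Node}
    (hx : (x, k) ∈ σ ↔ x ∈ U) :
    D.turn σ U (x, k) = (x, k - 1) ∧ D.turn σ U (x, k - 1) = (x, k) ∧
    D.turn σ U (x, k + 1) = (x, k + 2) ∧ D.turn σ U (x, k + 2) = (x, k + 1) := by
  have t1 : D.turn σ U (x, k) = (x, k - 1) := turn_pred (by rw [hx]; exact iff_not_self)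
  have t3 : D.turn σ U (x, k + 1) = (x, k + 1 + 1) :=
    turn_succ ((h.mem_succ x k).trans (not_congr hx))
  rw [add_assoc, (by decide : (1 : Fin 4) + 1 = 2)] at t3
  exact ⟨t1, by rw [← t1, h.turn_turn], t3, by rw [← t3, h.turn_turn]⟩

open Classical in
/-- `turn` for the enlarged diagram, written on the pairs that make up its ports. -/
noncomputable def attachTurn (D : Diagram) (σ : Set D.Flag) (c : D.Node)
    (V : Set (Option D.Node)) (q : Option D.Node × Fin 4) : Option D.Node × Fin 4 :=
  if (q.1.getD c, q.2) ∈ σ ↔ q.1 ∉ V then (q.1, q.2 + 1) else (q.1, q.2 - 1)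

variable {V : Set (Option D.Node)}

theorem attachTurn_eq_of_mem_iff {y : Option D.Node} (hy : y ∈ V ↔ y.getD c ∈ U) (j : Fin 4) :
    D.attachTurn σ c V (y, j) = (y, (D.turn σ U (y.getD c, j)).2) := by
  have hσ : ((y.getD c, j) ∈ σ ↔ y ∉ V) ↔ ((y.getD c, j) ∈ σ ↔ y.getD c ∉ U) := by rw [hy]
  by_cases hj : (y.getD c, j) ∈ σ ↔ y.getD c ∉ U
  · rw [turn_succ hj, attachTurn, if_pos (hσ.2 hj)]
  · rw [turn_pred hj, attachTurn, if_neg (mt hσ.1 hj)]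

theorem reflect_port (k : Fin 4) : k + k - 1 - k = k - 1 ∧ k + k - 1 - (k - 1) = k ∧
    k + k - 1 - (k + 1) = k + 2 ∧ k + k - 1 - (k + 2) = k + 1 := by
  revert k; decide

theorem IsCheckerboard.attachTurn_through (h : D.IsCheckerboard σ) {y : Option D.Node}
    (hyc : y.getD c = c) (hy : (c, k) ∈ σ ↔ y ∈ V) (j : Fin 4) :
    D.attachTurn σ c V (y, j) = (y, k + k - 1 - j) := by
  have hyU : y ∈ V ↔ y.getD c ∈ {_x : D.Node | y ∈ V} := .rfl
  obtain ⟨t1, t2, t3, t4⟩ := h.turn_through (U := {_x | y ∈ V}) (hyc.symm ▸ hy)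
  obtain ⟨r1, r2, r3, r4⟩ := reflect_port k
  rcases fin_four_cases k j with rfl | rfl | rfl | rfl <;>
    simp only [attachTurn_eq_of_mem_iff hyU, t1, t2, t3, t4, r1, r2, r3, r4]

theorem IsCheckerboard.attachTurn_cap (h : D.IsCheckerboard σ) {y : Option D.Node}
    (hyc : y.getD c = c) (hy : (c, k) ∈ σ ↔ y ∉ V) :
    D.attachTurn σ c V (y, k) = (y, k + 1) ∧ D.attachTurn σ c V (y, k + 1) = (y, k) ∧
    D.attachTurn σ c V (y, k + 2) = (y, k - 1) ∧ D.attachTurn σ c V (y, k - 1) = (y, k + 2) := by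
  have hyU : y ∈ V ↔ y.getD c ∈ {_x : D.Node | y ∈ V} := .rfl
  obtain ⟨t1, t2, t3, t4⟩ := h.turn_cap (U := {_x | y ∈ V}) (hyc.symm ▸ hy)
  simp only [attachTurn_eq_of_mem_iff hyU, t1, t2, t3, t4, and_self]

/-- The nodes `a` and `b` are, in one order or the other, the new node and the old node `c`. -/
def IsAttachedPair (D : Diagram) (c : D.Node) (a b : Option D.Node) : Prop :=
  a = none ∧ b = some c ∨ a = some c ∧ b = none

-- Reflection in the axis from `c` to the new node maps the port `j` to `k + k - 1 - j`.
theorem IsAttachedPair.port_cases {a b : Option D.Node} (hab : D.IsAttachedPair c a b)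
    (k j : Fin 4) :
    (D.attachPort c k (c, j) = (a, j) ∧ D.attachPort c k (c, k + k - 1 - j) = (b, k + k - 1 - j) ∧
      D.attachGlue c k (b, j) = (a, k + k - 1 - j)) ∨
    (D.attachPort c k (c, j) = (b, j) ∧ D.attachPort c k (c, k + k - 1 - j) = (a, k + k - 1 - j) ∧
      D.attachGlue c k (a, j) = (b, k + k - 1 - j)) := by
  obtain ⟨e1, e2, e3, e4⟩ := D.attachGlue_inner c k
  obtain ⟨r1, r2, r3, r4⟩ := reflect_port k
  rcases hab with ⟨rfl, rfl⟩ | ⟨rfl, rfl⟩ <;>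
    rcases fin_four_cases k j with rfl | rfl | rfl | rfl <;>
    simp [*, attachPort_none, attachPort_some]

theorem IsAttachedPair.getD_left {a b : Option D.Node} (hab : D.IsAttachedPair c a b) :
    a.getD c = c := by
  rcases hab with ⟨rfl, -⟩ | ⟨rfl, -⟩ <;> rfl

theorem IsAttachedPair.getD_right {a b : Option D.Node} (hab : D.IsAttachedPair c a b) :
    b.getD c = c := by
  rcases hab with ⟨-, rfl⟩ | ⟨-, rfl⟩ <;> rfl

theorem IsAttachedPair.ne {a b : Option D.Node} (hab : D.IsAttachedPair c a b) : b ≠ a := by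
  rcases hab with ⟨rfl, rfl⟩ | ⟨rfl, rfl⟩ <;> simp

theorem IsAttachedPair.eq_or_eq_or_exists {a b : Option D.Node} (hab : D.IsAttachedPair c a b)
    (y : Option D.Node) : y = a ∨ y = b ∨ ∃ x, x ≠ c ∧ y = some x := by
  by_cases hyc : y = some c
  · rcases hab with ⟨-, rfl⟩ | ⟨rfl, -⟩ <;> simp [hyc]
  · rcases hab with ⟨rfl, -⟩ | ⟨-, rfl⟩ <;> rcases y with _ | x <;> simp_all

open Classical in
/-- The port of `D` that remains of a port of the enlarged diagram when the node `a` is contracted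
along its two arcs, which run from the ports `k`, `k + 1` to the ports `k - 1`, `k + 2`. -/
noncomputable def contractPort (D : Diagram) (c : D.Node) (k : Fin 4) (a : Option D.Node)
    (q : Option D.Node × Fin 4) : D.Flag :=
  if q.1 = a ∧ D.attachPort c k (c, q.2) ≠ q then (c, k + k - 1 - q.2) else (q.1.getD c, q.2)

variable {a b : Option D.Node}

theorem contractPort_of_ne {y : Option D.Node} (hy : y ≠ a) (j : Fin 4) :
    D.contractPort c k a (y, j) = (y.getD c, j) :=
  if_neg fun h => hy h.1

theorem IsAttachedPair.contractPort_attachPort (hab : D.IsAttachedPair c a b) (p : D.Flag) :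
    D.contractPort c k a (D.attachPort c k p) = p := by
  obtain ⟨x, j⟩ := p
  by_cases hx : x = c
  · subst hx
    rw [contractPort, if_neg (by simp [attachPort_snd]), attachPort_getD, attachPort_snd]
  · rw [attachPort_of_ne hx, contractPort_of_ne]
    · rfl
    · rcases hab with ⟨rfl, -⟩ | ⟨rfl, -⟩ <;> simp [hx]

theorem IsAttachedPair.contractPort_facing (hab : D.IsAttachedPair c a b) {j : Fin 4}
    (hj : D.attachPort c k (c, j) = (b, j)) : D.contractPort c k a (a, j) = (c, k + k - 1 - j) :=
  if_pos ⟨rfl, by rw [hj]; simp [hab.ne]⟩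

theorem IsAttachedPair.contractPort_glue (hab : D.IsAttachedPair c a b)
    (q : Option D.Node × Fin 4) :
    D.contractPort c k a (D.attachGlue c k q) = D.contractPort c k a q ∨
      D.contractPort c k a (D.attachGlue c k q) = D.glue (D.contractPort c k a q) := by
  have outer (p : D.Flag) (hp : D.attachPort c k p = q) :
      D.contractPort c k a (D.attachGlue c k q) = D.glue (D.contractPort c k a q) := by
    rw [← hp, attachGlue_attachPort, hab.contractPort_attachPort, hab.contractPort_attachPort]
  obtain ⟨y, j⟩ := q
  rcases hab.eq_or_eq_or_exists y with rfl | rfl | ⟨x, hx, rfl⟩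
  · rcases hab.port_cases k j with ⟨h1, -, -⟩ | ⟨h1, -, hg⟩
    · exact .inr (outer _ h1)
    · rw [hg, contractPort_of_ne hab.ne, hab.contractPort_facing h1, hab.getD_right]
      exact .inl rfl
  · rcases hab.port_cases k j with ⟨-, h2, hg⟩ | ⟨h1, -, -⟩
    · rw [hg, contractPort_of_ne hab.ne, hab.contractPort_facing h2, hab.getD_right, sub_sub_cancel]
      exact .inl rfl
    · exact .inr (outer _ h1)
  · exact .inr (outer _ (attachPort_of_ne hx j))

open Classical in
theorem IsAttachedPair.contractPort_attachTurn_of_ne (hab : D.IsAttachedPair c a b)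
    {y : Option D.Node} (hy : y ≠ a) (j : Fin 4) :
    D.contractPort c k a (D.attachTurn σ c V (y, j)) =
      D.turn σ {x | (if x = c then b else some x) ∈ V} (D.contractPort c k a (y, j)) := by
  have hyU : y ∈ V ↔ y.getD c ∈ {x | (if x = c then b else some x) ∈ V} := by
    rcases hab.eq_or_eq_or_exists y with rfl | rfl | ⟨x, hx, rfl⟩
    · exact absurd rfl hy
    · simp [hab.getD_right]
    · simp [hx]
  rw [attachTurn_eq_of_mem_iff hyU, contractPort_of_ne hy, contractPort_of_ne hy]
  exact Prod.ext (turn_fst (y.getD c, j)).symm rfl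

theorem IsAttachedPair.contractPort_attachTurn_self (hab : D.IsAttachedPair c a b)
    (h : D.IsCheckerboard σ) (ha : (c, k) ∈ σ ↔ a ∈ V) (j : Fin 4) :
    D.contractPort c k a (D.attachTurn σ c V (a, j)) = D.contractPort c k a (a, j) := by
  rw [h.attachTurn_through hab.getD_left ha]
  rcases hab.port_cases k j with ⟨h1, h2, -⟩ | ⟨h1, h2, -⟩
  · rw [hab.contractPort_facing h2, sub_sub_cancel, ← h1, hab.contractPort_attachPort]
  · rw [hab.contractPort_facing h1, ← h2, hab.contractPort_attachPort]

theorem IsAttachedPair.attachPort_contractPort (hab : D.IsAttachedPair c a b)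
    (h : D.IsCheckerboard σ) (ha : (c, k) ∈ σ ↔ a ∈ V) (q : Option D.Node × Fin 4) :
    D.attachPort c k (D.contractPort c k a q) = q ∨
      D.attachPort c k (D.contractPort c k a q) = D.attachTurn σ c V q ∨
      D.attachPort c k (D.contractPort c k a q) = D.attachTurn σ c V (D.attachGlue c k q) := by
  obtain ⟨y, j⟩ := q
  rcases hab.eq_or_eq_or_exists y with rfl | rfl | ⟨x, hx, rfl⟩
  · rcases hab.port_cases k j with ⟨h1, -, -⟩ | ⟨h1, h2, -⟩
    · exact .inl (by rw [← h1, hab.contractPort_attachPort])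
    · exact .inr (.inl (by
        rw [hab.contractPort_facing h1, h2, h.attachTurn_through hab.getD_left ha]))
  · rcases hab.port_cases k j with ⟨h1, -, hg⟩ | ⟨h1, -, -⟩
    · exact .inr (.inr (by
        rw [contractPort_of_ne hab.ne, hab.getD_right, h1, hg,
          h.attachTurn_through hab.getD_left ha, sub_sub_cancel]))
    · exact .inl (by rw [← h1, hab.contractPort_attachPort])
  · exact .inl (by rw [← attachPort_of_ne hx, hab.contractPort_attachPort])

open Classical in
theorem IsCheckerboard.oneCircle_attach_of_through (h : D.IsCheckerboard σ)
    (hab : D.IsAttachedPair c a b) (ha : (c, k) ∈ σ ↔ a ∈ V) :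
    (D.attach c k e).OneCircle (D.attachColor σ c k e) V ↔
      D.OneCircle σ {x | (if x = c then b else some x) ∈ V} := by
  refine jointlyTransitive_iff_of_leftInverse (D.attach c k e).glue_glue
    ((h.attach c k e).turn_turn V) (f := D.attachPort c k) (g := D.contractPort c k a)
    hab.contractPort_attachPort (D.attachGlue_attachPort c k) hab.contractPort_glue
    (fun q => ?_) (fun p => ?_) (hab.attachPort_contractPort h ha)
  · by_cases hq : q.1 = a
    · exact .inl (hq ▸ hab.contractPort_attachTurn_self h ha q.2)
    · exact .inr (hab.contractPort_attachTurn_of_ne hq q.2)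
  · obtain ⟨y, hy, hyp⟩ : ∃ y, y ≠ a ∧ y.getD c = p.1 := by
      by_cases hp : p.1 = c
      · exact ⟨b, hab.ne, hab.getD_right.trans hp.symm⟩
      · exact ⟨some p.1, by rcases hab with ⟨rfl, -⟩ | ⟨rfl, -⟩ <;> simp [hp], rfl⟩
    have hg : D.contractPort c k a (y, p.2) = p := by rw [contractPort_of_ne hy, hyp]
    exact ⟨_, hg, (hab.contractPort_attachTurn_of_ne hy p.2).trans (congrArg _ hg)⟩

theorem IsCheckerboard.not_oneCircle_attach (h : D.IsCheckerboard σ)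
    (hnone : (c, k) ∈ σ ↔ none ∉ V) (hsome : (c, k) ∈ σ ↔ some c ∉ V) :
    ¬ (D.attach c k e).OneCircle (D.attachColor σ c k e) V := by
  obtain ⟨e1, e2, e3, e4⟩ := D.attachGlue_inner c k
  obtain ⟨-, -, n3, n4⟩ := h.attachTurn_cap rfl hnone
  obtain ⟨s1, s2, -, -⟩ := h.attachTurn_cap rfl hsome
  intro hV
  have hall : ({(none, k - 1), (none, k + 2), (some c, k), (some c, k + 1)} :
      Set (Option D.Node × Fin 4)) = univ := hV _ ⟨_, .inl rfl⟩ ?_ ?_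
  · have hk : ∀ k : Fin 4, k ≠ k - 1 ∧ k ≠ k + 2 := by decide
    have := eq_univ_iff_forall.1 hall (none, k)
    simp [hk k] at this
  · rintro q (rfl | rfl | rfl | rfl)
    exacts [.inr (.inr (.inl e1)), .inr (.inr (.inr e2)), .inl e3, .inr (.inl e4)]
  · rintro q (rfl | rfl | rfl | rfl)
    exacts [.inr (.inl n4), .inl n3, .inr (.inr (.inr s1)), .inr (.inr (.inl s2))]

open Classical in
/-- The face of `D` which a corner of the enlarged diagram comes from, or `none` at the two corners
that bound the new face between the new node and `c`. -/
noncomputable def attachFace (D : Diagram) (c : D.Node) (k : Fin 4)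
    (q : Option D.Node × Fin 4) : Option D.Face :=
  if q = (none, k + 2) ∨ q = (some c, k) then none else some (D.face (q.1.getD c, q.2))

theorem attachFace_of_ne {x : D.Node} (hx : x ≠ c) (j : Fin 4) :
    D.attachFace c k (some x, j) = some (D.face (x, j)) :=
  if_neg (by simp [hx])

theorem attachFace_none {j : Fin 4} (hj : j ≠ k + 2) :
    D.attachFace c k (none, j) = some (D.face (c, j)) :=
  if_neg (by simp [hj])

theorem attachFace_some {j : Fin 4} (hj : j ≠ k) :
    D.attachFace c k (some c, j) = some (D.face (c, j)) :=
  if_neg (by simp [hj])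

theorem attachFace_attachPort (p : D.Flag) :
    D.attachFace c k (D.attachPort c k p) = some (D.face p) ∧
    D.attachFace c k ((D.attachPort c k p).1, p.2 - 1) = some (D.face (p.1, p.2 - 1)) := by
  have hk : ∀ k : Fin 4, k ≠ k + 2 ∧ k - 1 ≠ k + 2 ∧ k + 1 ≠ k + 2 ∧ k + 1 - 1 ≠ k + 2 ∧
    k - 1 ≠ k ∧ k - 1 - 1 ≠ k ∧ k + 2 ≠ k ∧ k + 2 - 1 ≠ k := by decide
  obtain ⟨k1, k2, k3, k4, k5, k6, k7, k8⟩ := hk k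
  obtain ⟨x, j⟩ := p
  by_cases hx : x = c
  · subst hx
    rcases fin_four_cases k j with rfl | rfl | rfl | rfl
    · rw [attachPort_none (.inl rfl)]
      exact ⟨attachFace_none k1, attachFace_none k2⟩
    · rw [attachPort_some (.inl rfl)]
      exact ⟨attachFace_some k5, attachFace_some k6⟩
    · rw [attachPort_none (.inr rfl)]
      exact ⟨attachFace_none k3, attachFace_none k4⟩
    · rw [attachPort_some (.inr rfl)]
      exact ⟨attachFace_some k7, attachFace_some k8⟩
  · rw [attachPort_of_ne hx]
    exact ⟨attachFace_of_ne hx j, attachFace_of_ne hx (j - 1)⟩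

theorem attachFace_across (q : (D.attach c k e).Flag) :
    D.attachFace c k ((D.attach c k e).across q) = D.attachFace c k q := by
  change D.attachFace c k ((D.attachGlue c k q).1, (D.attachGlue c k q).2 - 1) = _
  obtain ⟨e1, e2, e3, e4⟩ := D.attachGlue_inner c k
  have hk : ∀ k : Fin 4, k - 1 ≠ k + 2 ∧ k - 1 ≠ k ∧ k + 1 ≠ k + 2 ∧ k + 1 ≠ k ∧
    k - 1 - 1 = k + 2 ∧ k + 2 - 1 = k + 1 := by decide
  obtain ⟨k1, k2, k3, k4, k5, k6⟩ := hk k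
  rcases D.attach_cases c k q with ⟨p, rfl⟩ | rfl | rfl | rfl | rfl
  · rw [attachGlue_attachPort, attachPort_snd, (attachFace_attachPort (D.glue p)).2,
      (attachFace_attachPort p).1]
    exact congrArg some (face_across p)
  · rw [e1, attachFace_none k1]
    exact attachFace_some k2
  · simp only [e2, attachFace, add_sub_cancel_right, or_true, true_or, if_true]
  · simp only [e3, attachFace, k5, or_true, true_or, if_true]
  · simp only [e4, k6]
    rw [attachFace_none k3, attachFace_some k4]

theorem attachFace_surjective (D : Diagram) (c : D.Node) (k : Fin 4) :
    Function.Surjective (D.attachFace c k) := by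
  rintro (_ | f)
  · exact ⟨(some c, k), if_pos (.inr rfl)⟩
  · obtain ⟨p, rfl⟩ := D.face_surjective f
    exact ⟨_, (attachFace_attachPort p).1⟩

theorem card_face_add_one_le_attach (D : Diagram) (c : D.Node) (k : Fin 4) (e : Elem) :
    Nat.card D.Face + 1 ≤ Nat.card (D.attach c k e).Face := by
  rw [← Finite.card_option]
  refine Nat.card_le_card_of_surjective (Quot.lift (D.attachFace c k) ?_) ?_
  · rintro q _ rfl
    exact attachFace_across q |>.symm
  · exact Quot.surjective_lift _ |>.2 (D.attachFace_surjective c k)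

end Diagram

/-- The weight of two adjacent nodes of weights `w` and `z`, seen as one node: they let arcs pass
between each other and the rest of the diagram in the smoothing `t`. -/
def joinWeight (t : Bool) (w z : Bool → ℤ) (u : Bool) : ℤ :=
  if u = t then w t * z t else w t * z (!t) + w (!t) * z t

/-- The weight of a tangle, seen as one node; for `b` see `Elem.weight`. -/
def TwistTangle.weight (b : Bool) : TwistTangle → Bool → ℤ
  | .elem e => e.weight b
  | .addEast T e => joinWeight b (T.weight b) (e.weight b)
  | .addSouth T e => joinWeight (!b) (T.weight b) (e.weight b)

theorem prod_update_update {ι α M : Type*} [Fintype ι] [DecidableEq ι] [CommMonoid M]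
    (W : ι → α → M) (c : ι) (w : α → M) (s : ι → α) (u : α) :
    ∏ x, Function.update W c w x (Function.update s c u x) =
      w u * ∏ x ∈ Finset.univ \ {c}, W x (s x) := by
  rw [← Finset.prod_update_of_mem (Finset.mem_univ c)]
  refine Finset.prod_congr rfl fun x _ => ?_
  by_cases hx : x = c
  · subst hx; simp only [Function.update_self]
  · simp only [Function.update_of_ne hx]

namespace Diagram

open Set

variable {D : Diagram} {σ : Set D.Flag} {c : D.Node} {k : Fin 4} {e : Elem}

open Classical in
theorem stateSum_attach_eq_sum (W : (D.attach c k e).Node → Bool → ℤ) :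
    (D.attach c k e).stateSum (D.attachColor σ c k e) W =
      ∑ s : D.Node → Bool, ∑ v : Bool,
        if (D.attach c k e).OneCircle (D.attachColor σ c k e)
          {y : Option D.Node | y.elim v s = true}
        then W none v * ∏ x, W (some x) (s x) else 0 := by
  let E : (D.Node → Bool) × Bool ≃ ((D.attach c k e).Node → Bool) :=
    (Equiv.prodComm _ _).trans (Equiv.piOptionEquivProd (β := fun _ => Bool)).symm
  have hE (s : D.Node → Bool) (v : Bool) (y : Option D.Node) : E (s, v) y = y.elim v s := by
    cases y <;> rfl
  rw [← Fintype.sum_prod_type']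
  refine (Fintype.sum_equiv E _ _ fun p => ?_).symm
  have hprod : ∏ y, W y (E p y) = W none p.2 * ∏ x, W (some x) (p.1 x) :=
    (Fintype.prod_equiv (ι := (D.attach c k e).Node) (κ := Option D.Node) (.refl _)
      _ _ fun _ => rfl).trans (Fintype.prod_option fun y : Option D.Node => W y (E p y))
  rw [hprod]
  exact if_congr (by simp only [← hE]; rfl) rfl rfl

open Classical in
theorem IsCheckerboard.oneCircle_attach_iff (h : D.IsCheckerboard σ) {t : Bool}
    (ht : (c, k) ∈ σ ↔ t = true) (s : D.Node → Bool) (v : Bool) :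
    (D.attach c k e).OneCircle (D.attachColor σ c k e) {y : Option D.Node | y.elim v s = true} ↔
      s c = t ∧ D.OneCircle σ {x | Function.update s c v x = true} ∨
        v = t ∧ D.OneCircle σ {x | s x = true} := by
  have hsome (hs : s c = t) := h.oneCircle_attach_of_through (e := e) (b := none)
    (V := {y | y.elim v s = true}) (.inr ⟨rfl, rfl⟩) (ht.trans (by simp [hs]))
  have hnone (hv : v = t) := h.oneCircle_attach_of_through (e := e) (b := some c)
    (V := {y | y.elim v s = true}) (.inl ⟨rfl, rfl⟩) (ht.trans (by simp [hv]))
  have hsome_set : {x | (if x = c then none else some x) ∈ {y : Option D.Node | y.elim v s = true}}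
      = {x | Function.update s c v x = true} := by
    ext x
    by_cases hx : x = c
    · subst hx; simp
    · simp [hx]
  have hnone_set : {x | (if x = c then some c else some x) ∈
      {y : Option D.Node | y.elim v s = true}} = {x | s x = true} := by
    ext x
    by_cases hx : x = c
    · subst hx; simp
    · simp [hx]
  rw [hsome_set] at hsome
  rw [hnone_set] at hnone
  by_cases hs : s c = t
  · refine (hsome hs).trans ⟨fun hU => .inl ⟨hs, hU⟩, ?_⟩
    rintro (⟨-, hU⟩ | ⟨hv, hU⟩)
    · exact hU
    · rwa [hv, ← hs, Function.update_eq_self]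
  · by_cases hv : v = t
    · exact (hnone hv).trans (by simp only [hs, hv, false_and, true_and, false_or])
    · simp only [hs, hv, false_and, or_self, iff_false]
      have hne : ∀ {u : Bool}, u ≠ t → (t = true ↔ ¬ u = true) := by cases t <;> simp
      exact h.not_oneCircle_attach (ht.trans (hne hv)) (ht.trans (hne hs))

open Classical in
theorem IsCheckerboard.stateSum_attach (h : D.IsCheckerboard σ) {t : Bool}
    (ht : (c, k) ∈ σ ↔ t = true) (W : (D.attach c k e).Node → Bool → ℤ) :
    (D.attach c k e).stateSum (D.attachColor σ c k e) W =
      D.stateSum σ (Function.update (fun x => W (some x)) c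
        (joinWeight t (W (some c)) (W none))) := by
  rw [stateSum_attach_eq_sum]
  refine sum_eq_sum_of_sum_update_eq c fun s => ?_
  have hprod (u : Bool) := prod_update_update (fun x => W (some x)) c (W (some c)) s u
  rw [Function.update_eq_self c fun x => W (some x)] at hprod
  simp only [h.oneCircle_attach_iff ht, hprod, prod_update_update, Function.update_self,
    Function.update_idem, Fintype.sum_bool]
  by_cases h1 : D.OneCircle σ {x | Function.update s c true x = true} <;>
    by_cases h0 : D.OneCircle σ {x | Function.update s c false x = true} <;>
    cases t <;> simp [h1, h0, joinWeight] <;> ring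

open Classical in
theorem stateSum_update (W : D.Node → Bool → ℤ) (c : D.Node) (w : Bool → ℤ) (b : Bool) :
    D.stateSum σ (Function.update W c w) =
      w b * D.stateSum σ (Function.update W c (Elem.horiz.weight b)) +
        w (!b) * D.stateSum σ (Function.update W c (Elem.vert.weight b)) := by
  rw [stateSum, stateSum, stateSum, Finset.mul_sum, Finset.mul_sum, ← Finset.sum_add_distrib]
  refine Finset.sum_congr rfl fun s _ => ?_
  have hprod (w : Bool → ℤ) := prod_update_update W c w s (s c)
  simp only [Function.update_eq_self] at hprod
  simp only [hprod]
  cases b <;> cases s c <;> simp [Elem.weight]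

end Diagram

/-! ### Rational tangles -/

namespace Diagram

variable {D : Diagram} {σ : Set D.Flag} {c : D.Node}

open Classical in
theorem nodeWeight_setElem (D : Diagram) (σ : Set D.Flag) (c : D.Node) (e : Elem) :
    (D.setElem c e).nodeWeight σ =
      Function.update (D.nodeWeight σ) c (e.weight (decide ((c, 1) ∈ σ))) := by
  funext (x : D.Node)
  change (Function.update D.elem c e x).weight (decide ((x, 1) ∈ σ)) = _
  by_cases hx : x = c
  · subst hx
    rw [Function.update_self, Function.update_self]
  · rw [Function.update_of_ne hx, Function.update_of_ne hx]
    rfl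

open Classical in
theorem IsCheckerboard.stateSum_attach_update (h : D.IsCheckerboard σ) {k : Fin 4} {t : Bool}
    (ht : (c, k) ∈ σ ↔ t = true) (e : Elem) (w : Bool → ℤ) :
    (D.attach c k e).stateSum (D.attachColor σ c k e)
      (Function.update ((D.attach c k e).nodeWeight (D.attachColor σ c k e)) (some c) w) =
    D.stateSum σ (Function.update (D.nodeWeight σ) c
      (joinWeight t w (e.weight (decide ((c, 1) ∈ σ))))) := by
  set W := Function.update ((D.attach c k e).nodeWeight (D.attachColor σ c k e)) (some c) w
  have hself : W (some c) = w := Function.update_self ..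
  have hne (y : (D.attach c k e).Node) (hy : y ≠ some c) :
      W y = (D.attach c k e).nodeWeight (D.attachColor σ c k e) y := Function.update_of_ne hy ..
  have hnone : W none = e.weight (decide ((c, 1) ∈ σ)) := hne none (Option.some_ne_none c).symm
  have hsome (x : D.Node) (hx : x ≠ c) : W (some x) = D.nodeWeight σ x :=
    hne (some x) ((Option.some_injective _).ne hx)
  rw [h.stateSum_attach ht, hself, hnone]
  congr 1
  funext x
  by_cases hx : x = c
  · subst hx
    rw [Function.update_self, Function.update_self]
  · rw [Function.update_of_ne hx, Function.update_of_ne hx, hsome x hx]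

open Classical in
theorem exists_stateSum_replace (T : TwistTangle) : ∀ (D : Diagram) (c : D.Node)
    (σ : Set D.Flag), D.IsCheckerboard σ → Nat.card D.Node + 2 ≤ Nat.card D.Face →
    ∃ τ, (D.replace c T).IsCheckerboard τ ∧
      Nat.card (D.replace c T).Node + 2 ≤ Nat.card (D.replace c T).Face ∧
      (D.replace c T).stateSum τ ((D.replace c T).nodeWeight τ) =
        D.stateSum σ (Function.update (D.nodeWeight σ) c (T.weight (decide ((c, 1) ∈ σ)))) := by
  have hcard : ∀ (D : Diagram) (c : D.Node) (k : Fin 4) (e : Elem),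
      Nat.card D.Node + 2 ≤ Nat.card D.Face →
      Nat.card (D.attach c k e).Node + 2 ≤ Nat.card (D.attach c k e).Face := fun D c k e hF => by
    rw [card_attach]
    exact (Nat.succ_le_succ hF).trans (D.card_face_add_one_le_attach c k e)
  induction T with
  | elem e => exact fun D c σ h hF => ⟨σ, h, hF, congrArg _ (D.nodeWeight_setElem σ c e)⟩
  | addEast T e ih =>
    intro D c σ h hF
    obtain ⟨τ, hτ, hτF, hsum⟩ := ih _ (some c) _ (h.attach c 3 e) (hcard D c 3 e hF)
    refine ⟨τ, hτ, hτF, hsum.trans (h.stateSum_attach_update ?_ e _)⟩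
    exact (h.mem_opp c 1).trans decide_eq_true_iff.symm
  | addSouth T e ih =>
    intro D c σ h hF
    obtain ⟨τ, hτ, hτF, hsum⟩ := ih _ (some c) _ (h.attach c 2 e) (hcard D c 2 e hF)
    refine ⟨τ, hτ, hτF, hsum.trans (h.stateSum_attach_update ?_ e _)⟩
    exact (h.mem_succ c 1).trans (by simp)

open Classical in
theorem det_replace (h : D.IsCheckerboard σ) (hF : Nat.card D.Node + 2 ≤ Nat.card D.Face)
    (c : D.Node) (T : TwistTangle) : ((D.replace c T).det : ℤ) =
      |D.stateSum σ (Function.update (D.nodeWeight σ) c (T.weight (decide ((c, 1) ∈ σ))))| := by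
  obtain ⟨τ, hτ, hτF, hsum⟩ := exists_stateSum_replace T D c σ h hF
  rw [det_eq_abs_stateSum hτ hτF, hsum]

end Diagram

theorem Elem.exists_weight_reflect (e : Elem) (b : Bool) : ∃ ε : ℤ, |ε| = 1 ∧
    ∀ u, e.reflect.weight b u = ε * e.weight b (!u) := by
  rcases e <;> cases b <;>
    first | exact ⟨1, by simp, by decide⟩ | exact ⟨-1, by simp, by decide⟩

namespace TwistTangle

theorem exists_weight_reflect (T : TwistTangle) (b : Bool) : ∃ ε : ℤ, |ε| = 1 ∧
    ∀ u, T.reflect.weight b u = ε * T.weight b (!u) := by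
  have hjoin : ∀ {t : Bool} {w z w' z' : Bool → ℤ}, (∃ ε : ℤ, |ε| = 1 ∧ ∀ u, w' u = ε * w (!u)) →
      (∃ ε : ℤ, |ε| = 1 ∧ ∀ u, z' u = ε * z (!u)) →
      ∃ ε : ℤ, |ε| = 1 ∧ ∀ u, joinWeight (!t) w' z' u = ε * joinWeight t w z (!u) := by
    rintro t w z w' z' ⟨ε, hε, hw⟩ ⟨δ, hδ, hz⟩
    refine ⟨ε * δ, by rw [abs_mul, hε, hδ, one_mul], fun u => ?_⟩
    cases t <;> cases u <;> simp [joinWeight, hw, hz] <;> ring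
  induction T with
  | elem e => exact e.exists_weight_reflect b
  | addEast T e ih => exact hjoin ih (e.exists_weight_reflect b)
  | addSouth T e ih =>
    have := hjoin (t := !b) ih (e.exists_weight_reflect b)
    rwa [Bool.not_not] at this

theorem weight_iterate_addEast {e : Elem} {b : Bool} (he : e.weight b (!b) = -e.weight b b)
    (T : TwistTangle) (n : ℕ) :
    ((fun T => addEast T e)^[n] T).weight b b = e.weight b b ^ n * T.weight b b ∧
      ((fun T => addEast T e)^[n] T).weight b (!b) =
        e.weight b b ^ n * (T.weight b (!b) - n * T.weight b b) := by
  induction n with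
  | zero => simp
  | succ n ih =>
    rw [Function.iterate_succ_apply', weight, joinWeight, joinWeight, if_pos rfl,
      if_neg (Bool.not_ne_self b), ih.1, ih.2, he]
    push_cast
    constructor <;> ring

theorem rational_concat (a : List ℤ) (m : ℤ) :
    rational (a ++ [m]) = (rational a).reflect.twist m := by
  simp only [rational, List.foldl_append, List.foldl_cons, List.foldl_nil]

end TwistTangle

theorem contFrac_concat (a : List ℤ) (m : ℤ) : contFrac (a ++ [m]) = ((m : ℚ) + contFrac a)⁻¹ := by
  simp [contFrac]

theorem mul_num_contFrac_nonneg {s : ℤ} {a : List ℤ} (ha : ∀ m ∈ a, 0 < s * m) :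
    0 ≤ s * (contFrac a).num := by
  suffices 0 ≤ (s : ℚ) * contFrac a by
    have h := mul_nonneg this (Nat.cast_nonneg (contFrac a).den)
    rw [mul_assoc, Rat.mul_den_eq_num] at h
    exact_mod_cast h
  induction a using List.reverseRecOn with
  | nil => simp [contFrac]
  | append_singleton a m ih =>
    have hm : (0 : ℚ) < s * m := mod_cast ha m (by simp)
    have hq := ih fun m hm => ha m (List.mem_append_left _ hm)
    have hsum : (0 : ℚ) ≤ s * (m + contFrac a) := by rw [mul_add]; positivity
    rwa [contFrac_concat, ← div_eq_mul_inv, div_nonneg_iff, ← mul_nonneg_iff]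

theorem num_intCast_add (m : ℤ) (q : ℚ) : ((m : ℚ) + q).num = m * q.den + q.num := by
  have h := ((m : ℚ) + q).mul_den_eq_num
  rw [Rat.intCast_add_den, add_mul, Rat.mul_den_eq_num] at h
  exact_mod_cast h.symm

theorem den_and_abs_num_inv_intCast_add {m : ℤ} {q : ℚ} (hm : m ≠ 0) (hmq : 0 ≤ m * q.num) :
    (((m : ℚ) + q)⁻¹.den : ℤ) = m.natAbs * q.den + |q.num| ∧ |((m : ℚ) + q)⁻¹.num| = q.den := by
  have hden : (0 : ℤ) < q.den := mod_cast q.den_pos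
  have habs : |((m : ℚ) + q).num| = m.natAbs * q.den + |q.num| := by
    rw [num_intCast_add, Int.natCast_natAbs]
    rcases lt_or_gt_of_ne hm with hm | hm
    · have hq := nonpos_of_mul_nonneg_right hmq hm
      rw [abs_of_neg hm, abs_of_nonpos hq, abs_of_neg (by nlinarith)]
      ring
    · have hq := nonneg_of_mul_nonneg_right hmq hm
      rw [abs_of_pos hm, abs_of_nonneg hq, abs_of_pos (by positivity)]
  have hne : ((m : ℚ) + q).num ≠ 0 := by
    rw [← abs_pos, habs]
    positivity
  constructor
  · rw [Rat.den_inv_of_ne_zero (Rat.num_ne_zero.1 hne), Int.natCast_natAbs, habs]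
  · rw [Rat.num_inv, abs_mul, Rat.intCast_add_den, Int.abs_sign_of_ne_zero hne, one_mul,
      Nat.abs_cast]

namespace TwistTangle

theorem exists_weight_rational {s : ℤ} {a : List ℤ} (ha : ∀ m ∈ a, 0 < s * m) :
    ∃ ε : ℤ, |ε| = 1 ∧
      (rational a).weight (decide (0 < s)) (!decide (0 < s)) = ε * (contFrac a).den ∧
      (rational a).weight (decide (0 < s)) (decide (0 < s)) = -(ε * |(contFrac a).num|) := by
  induction a using List.reverseRecOn with
  | nil => exact ⟨1, abs_one, by simp [rational, weight, Elem.weight, contFrac]⟩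
  | append_singleton a m ih =>
    have ha' : ∀ m ∈ a, 0 < s * m := fun m hm => ha m (List.mem_append_left _ hm)
    have hsm : 0 < s * m := ha m (by simp)
    have hm : m ≠ 0 := right_ne_zero_of_mul hsm.ne'
    have hmq : 0 ≤ m * (contFrac a).num := by
      have := mul_nonneg hsm.le (mul_num_contFrac_nonneg ha')
      have hs : 0 < s * s := mul_self_pos.2 (left_ne_zero_of_mul hsm.ne')
      exact nonneg_of_mul_nonneg_right (by linarith : 0 ≤ s * s * (m * (contFrac a).num)) hs
    have hsign : 0 < m ↔ 0 < s := (pos_iff_pos_of_mul_pos hsm).symm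
    set b := decide (0 < s)
    obtain ⟨ε, hε, hvert, hhoriz⟩ := ih ha'
    obtain ⟨δ, hδ, hreflect⟩ := (rational a).exists_weight_reflect b
    rw [rational_concat, contFrac_concat, twist]
    set e := if 0 < m then Elem.pos else Elem.neg
    have he : e.weight b (!b) = -e.weight b b ∧ |e.weight b b| = 1 := by
      by_cases hs : 0 < s <;> simp [e, b, hsign, hs, Elem.weight]
    obtain ⟨hself, hnot⟩ := weight_iterate_addEast he.1 (rational a).reflect m.natAbs
    obtain ⟨hden, hnum⟩ := den_and_abs_num_inv_intCast_add hm hmq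
    rw [hself, hnot, hreflect, hreflect, Bool.not_not, hvert, hhoriz, hden, hnum]
    refine ⟨-(e.weight b b ^ m.natAbs * δ * ε), ?_, by ring, by ring⟩
    rw [abs_neg, abs_mul, abs_mul, abs_pow, he.2, hδ, hε, one_pow, one_mul, one_mul]

end TwistTangle

theorem abs_mul_sub_mul_eq_sgn {A B p q z : ℤ} (hz : p ≠ 0 → q ≠ 0 → z = -(p * q)) :
    |A * p - B * q| = |(A * |p| + sgn z * B * |q|)| := by
  have hsgn : |sgn z| = 1 := by unfold sgn; split_ifs <;> simp
  by_cases hp : p = 0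
  · simp [hp, abs_mul, hsgn]
  by_cases hq : q = 0
  · simp [hq, abs_mul]
  suffices A * |p| + sgn z * B * |q| = p.sign * (A * p - B * q) by
    rw [this, abs_mul, Int.abs_sign_of_ne_zero hp, one_mul]
  have hsgn_sign : sgn z = -(p.sign * q.sign) := by
    rw [hz hp hq, ← Int.sign_mul, ← Int.sign_neg, sgn]
    split_ifs with h
    · exact (Int.sign_eq_one_of_pos (h.lt_of_ne' (by simp [hp, hq]))).symm
    · exact (Int.sign_eq_neg_one_of_neg (not_le.1 h)).symm
  rw [hsgn_sign, ← Int.sign_mul_self_eq_abs p, ← Int.sign_mul_self_eq_abs q]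
  have hq2 : q.sign * q.sign = 1 := by rw [← abs_mul_abs_self, Int.abs_sign_of_ne_zero hq, one_mul]
  linear_combination (-p.sign * B * q) * hq2

namespace Diagram

variable {D : Diagram} {σ : Set D.Flag} {c : D.Node}

theorem IsPlanar.card_node_add_two_le (hD : D.IsPlanar) (c : D.Node) :
    Nat.card D.Node + 2 ≤ Nat.card D.Face := by
  have := D.finite
  have hcomponents : 0 < Nat.card (Quot fun x y : D.Node => ∃ i, (D.glue (x, i)).1 = y) :=
    Nat.card_pos_iff.2 ⟨⟨Quot.mk _ c⟩, inferInstance⟩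
  change _ = Nat.card D.Face at hD
  omega

theorem shiftedTreeSum_eq_neg_treeSum (D : Diagram) (σ : Set D.Flag) :
    D.shiftedTreeSum σ = -D.treeSum σ := by
  rw [shiftedTreeSum, treeSum, ← Finset.sum_neg_distrib]
  exact Finset.sum_congr rfl fun v _ => by ring

theorem treeSum_eq_stateSum_of_ne_zero (h : D.IsCheckerboard σ)
    (hF : Nat.card D.Node + 2 ≤ Nat.card D.Face) (h0 : D.stateSum σ (D.nodeWeight σ) ≠ 0) :
    D.treeSum σ = D.stateSum σ (D.nodeWeight σ) :=
  treeSum_eq_stateSum h hF (not_not.1 fun hD => h0 (stateSum_eq_zero h hD))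

theorem det_replace_rational (h : D.IsCheckerboard σ) (hF : Nat.card D.Node + 2 ≤ Nat.card D.Face)
    {s : ℤ} (hs : (c, 1) ∈ σ ↔ 0 < s) {a : List ℤ} (ha : ∀ m ∈ a, 0 < s * m) :
    ((D.replace c (TwistTangle.rational a)).det : ℤ) =
      |((contFrac a).den * (D.setElem c .vert).det +
        sgn (-((D.setElem c .vert).treeSum σ * (D.setElem c .horiz).treeSum σ)) *
          |(contFrac a).num| * (D.setElem c .horiz).det)| := by
  classical
  set p : Elem → ℤ := fun e =>
    D.stateSum σ (Function.update (D.nodeWeight σ) c (e.weight (decide (0 < s))))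
  have hdet (T : TwistTangle) := det_replace h hF c T
  simp only [hs] at hdet
  have hsum (e : Elem) : (D.setElem c e).stateSum σ ((D.setElem c e).nodeWeight σ) = p e := by
    rw [nodeWeight_setElem]
    simp only [hs]
    rfl
  have htree (e : Elem) (he : p e ≠ 0) : (D.setElem c e).treeSum σ = p e :=
    (treeSum_eq_stateSum_of_ne_zero (D := D.setElem c e) h hF ((hsum e).trans_ne he)).trans
      (hsum e)
  have hdet_elem (e : Elem) : ((D.setElem c e).det : ℤ) = |p e| := hdet (.elem e)
  obtain ⟨ε, hε, hvert, hhoriz⟩ := TwistTangle.exists_weight_rational ha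
  rw [hdet, hdet_elem, hdet_elem,
    ← abs_mul_sub_mul_eq_sgn fun hp hq => by rw [htree _ hp, htree _ hq],
    stateSum_update _ _ _ (decide (0 < s)), hvert, hhoriz]
  change |_ * p .horiz + _ * p .vert| = _
  rw [← one_mul (abs (_ - _)), ← hε, ← abs_mul]
  congr 1
  ring

end Diagram

theorem lemma2p2 (D : Diagram) (hD : D.IsPlanar) (c : D.Node)
    (σ : Set D.Flag) (hσ : D.IsCheckerboard σ) (hc : D.IsPositiveEdge σ c)
    (x y : ℤ) (hx : x = (D.smoothA c).shiftedTreeSum σ) (hy : y = (D.smoothB c).treeSum σ)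
    (a : List ℤ) (ha : a ≠ []) (α β : ℤ) (hα : 0 < α) (hαβ : IsCoprime α β)
    (hslope : contFrac a = (β : ℚ) / α) :
    (D.elem c = Elem.pos → (∀ m ∈ a, 0 < m) →
      ((D.replace c (TwistTangle.rational a)).det : ℤ) =
        |α * (D.smoothA c).det + sgn (x * y) * β * (D.smoothB c).det|) ∧
    (D.elem c = Elem.neg → (∀ m ∈ a, m < 0) →
      ((D.replace c (TwistTangle.rational a)).det : ℤ) =
        |α * (D.smoothB c).det + sgn (x * y) * |β| * (D.smoothA c).det|) := by
  have hF := hD.card_node_add_two_le c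
  have hcop := Int.isCoprime_iff_nat_coprime.1 hαβ.symm
  have hnum : (contFrac a).num = β := hslope ▸ Rat.num_div_eq_of_coprime hα hcop
  have hden : ((contFrac a).den : ℤ) = α := hslope ▸ Rat.den_div_eq_of_coprime hα hcop
  have hxy {e : Elem} (he : D.elem c = e) :
      x * y = -((D.setElem c e.smoothA).treeSum σ * (D.setElem c e.smoothB).treeSum σ) := by
    subst he hx hy
    exact (congrArg (· * _) (Diagram.shiftedTreeSum_eq_neg_treeSum _ _)).trans (neg_mul _ _)
  rw [← hnum, ← hden, Diagram.smoothA, Diagram.smoothB]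
  constructor <;> intro hcross hsign <;> rw [hxy hcross] <;>
    simp only [Diagram.IsPositiveEdge, hcross, reduceCtorEq, true_and, false_and, or_false,
      false_or] at hc ⊢
  · have hpos : ∀ m ∈ a, 0 < 1 * m := by simpa using hsign
    have hβ := one_mul (contFrac a).num ▸ mul_num_contFrac_nonneg hpos
    rw [Diagram.det_replace_rational hσ hF (iff_of_true hc one_pos) hpos, abs_of_nonneg hβ]
    rfl
  · have hW : (c, 1) ∉ σ := fun h => (hσ.mem_succ c 0).1 h hc
    have hneg : ∀ m ∈ a, 0 < -1 * m := by simpa using hsign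
    rw [Diagram.det_replace_rational hσ hF (iff_of_false hW (by decide)) hneg]
    exact congrArg (fun z => |_ + sgn (-z) * _ * _|) (mul_comm _ _)
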